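/- Let $G$ be a finite-dimensional Lie group, $M$ a connected $C^\infty$ manifold, and $p\colon E_G\to M$ a $C^\infty$ principal $G$-bundle (all manifolds are finite-dimensional, Hausdorff and second countable). Let $\mathrm{At}(E_G)=(TE_G)/G$ be the Atiyah bundle, whose fiber over $x\in M$ is the space of $G$-invariant sections of $TE_G$ along $p^{-1}(x)$; let $\mathrm{ad}(E_G)=\ker(dp)/G\subset \mathrm{At}(E_G)$ be the adjoint bundle, $\iota_0\colon \mathrm{ad}(E_G)\to\mathrm{At}(E_G)$ the inclusion, and $\eta\colon \mathrm{At}(E_G)\to TM$ the surjective homomorphism of vector bundles induced by $dp$. A connection on $E_G$ is a $C^\infty$ homomorphism of vector bundles $D\colon TM\to\mathrm{At}(E_G)$ with $\eta\circ D=\mathrm{Id}_{TM}$. Using the canonical identifications $\mathrm{At}(E_G)\otimes T^*M=\mathrm{Hom}(TM,\mathrm{At}(E_G))$ and $TM\otimes T^*M=\mathrm{End}(TM)$, under which $\eta\otimes\mathrm{Id}_{T^*M}$ is composition with $\eta$, put $$\delta\colon \mathcal C(E_G):=(\eta\otimes \mathrm{Id}_{T^*M})^{-1}(\mathrm{Id}_{TM})\subset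 \mathrm{At}(E_G)\otimes T^*M\longrightarrow M .$$ For every $x\in M$ the vector space $\mathrm{Hom}(T_xM,\mathrm{ad}(E_G)_x)$ acts on the fiber $\mathcal C(E_G)_x$ by $A+\varphi:=\iota_0\circ A+\varphi$. Then $\mathcal C(E_G)$ is an embedded $C^\infty$ submanifold of $\mathrm{At}(E_G)\otimes T^*M$, and with this structure $\delta$ is a $C^\infty$ affine bundle over $M$ modeled on the vector bundle $\mathrm{Hom}(TM,\mathrm{ad}(E_G))$: each fiber $\mathcal C(E_G)_x$ is an affine space for $\mathrm{Hom}(T_xM,\mathrm{ad}(E_G)_x)$ under the above action, and $M$ is covered by open sets over which $\mathcal C(E_G)$ has a $C^\infty$ local trivialization that is affine on fibers and whose linear part is a $C^\infty$ local trivialization of $\mathrm{Hom}(TM,\mathrm{ad}(E_G))$. Consequently, for every connection $D$ on $E_G$ the map $A\mapsto \iota_0\circ A+D(x)$, for $A\in \mathrm{Hom}(T_xM,\mathrm{ad}(E_G)_x)$ and $x\in M$, is a diffeomorphism over $M$ from the total space of $\mathrm{Hom}(TM,\mathrm{ad}(E_G))$ onto $\mathcal C(E_G)$. Moreover, a connection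 on $E_G$ exists. -/

import Mathlib

set_option linter.unusedSectionVars false

open scoped Manifold ContDiff Topology
open Bundle Set

section LinearCharts

variable {EB : Type*} [NormedAddCommGroup EB] [NormedSpace ℝ EB]
  {B : Type*} [TopologicalSpace B] [ChartedSpace EB B]
  {F : Type*} [NormedAddCommGroup F] [NormedSpace ℝ F]
  {V : B → Type*} [∀ x, AddCommGroup (V x)] [∀ x, Module ℝ (V x)] [∀ x, TopologicalSpace (V x)]

/-- A family of fibrewise linear charts for a family of vector spaces `V x`, with smooth
transition functions. -/
structure LinearCharts (EB : Type*) [NormedAddCommGroup EB] [NormedSpace ℝ EB]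
    {B : Type*} [TopologicalSpace B] [ChartedSpace EB B]
    (F : Type*) [NormedAddCommGroup F] [NormedSpace ℝ F]
    (V : B → Type*) [∀ x, AddCommGroup (V x)] [∀ x, Module ℝ (V x)]
    [∀ x, TopologicalSpace (V x)] (ι : Type*) where
  dom : ι → Set B
  isOpen_dom : ∀ i, IsOpen (dom i)
  chart : ι → ∀ x, V x →ₗ[ℝ] F
  inv : ι → ∀ x, F →ₗ[ℝ] V x
  inv_chart : ∀ i, ∀ x ∈ dom i, ∀ v, inv i x (chart i x v) = v
  chart_inv : ∀ i, ∀ x ∈ dom i, ∀ v, chart i x (inv i x v) = v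
  pref : B → ι
  mem_pref : ∀ x, x ∈ dom (pref x)
  transition : ∀ i j, ∃ c : B → F →L[ℝ] F,
    ContMDiffOn 𝓘(ℝ, EB) 𝓘(ℝ, F →L[ℝ] F) ∞ c (dom i ∩ dom j) ∧
      ∀ x ∈ dom i ∩ dom j, ∀ v, c x v = chart j x (inv i x v)
  isInducing : ∀ x, Topology.IsInducing (chart (pref x) x)

namespace LinearCharts

variable {ι : Type*} (L : LinearCharts EB F V ι)

/-- The local trivialization `(x, v) ↦ (x, chart i x v)`. -/
def pretriv (i : ι) : Pretrivialization F (π F V) where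
  toFun v := (v.proj, L.chart i v.proj v.snd)
  invFun y := ⟨y.1, L.inv i y.1 y.2⟩
  source := π F V ⁻¹' L.dom i
  target := L.dom i ×ˢ univ
  map_source' v hv := ⟨hv, mem_univ _⟩
  map_target' y hy := hy.1
  left_inv' v hv := by
    obtain ⟨x, v⟩ := v
    simp only [TotalSpace.mk.injEq, heq_eq_eq, true_and]
    exact L.inv_chart i x hv v
  right_inv' y hy := by
    obtain ⟨x, v⟩ := y
    exact Prod.ext rfl (L.chart_inv i x hy.1 v)
  open_target := (L.isOpen_dom i).prod isOpen_univ
  baseSet := L.dom i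
  open_baseSet := L.isOpen_dom i
  source_eq := rfl
  target_eq := rfl
  proj_toFun _ _ := rfl

lemma pretriv_symm (i : ι) {x : B} (hx : x ∈ L.dom i) (v : F) :
    (L.pretriv i).symm x v = L.inv i x v := by
  have h := (L.pretriv i).mk_symm (b := x) hx v
  have h2 : (L.pretriv i).toPartialEquiv.symm (x, v) = ⟨x, L.inv i x v⟩ := rfl
  rw [h2] at h
  simpa using h

/-- The vector prebundle of a family of linear charts. -/
def prebundle : VectorPrebundle ℝ F V where
  pretrivializationAtlas := range L.pretriv
  pretrivialization_linear' := by
    rintro _ ⟨i, rfl⟩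
    exact ⟨fun x _ => ⟨fun v w => (L.chart i x).map_add v w, fun c v => (L.chart i x).map_smul c v⟩⟩
  pretrivializationAt x := L.pretriv (L.pref x)
  mem_base_pretrivializationAt := L.mem_pref
  pretrivialization_mem_atlas x := mem_range_self _
  exists_coordChange := by
    rintro _ ⟨i, rfl⟩ _ ⟨j, rfl⟩
    obtain ⟨c, hc, h⟩ := L.transition i j
    exact ⟨c, hc.continuousOn, fun x hx v => by rw [h x hx, L.pretriv_symm i hx.1]; rfl⟩
  totalSpaceMk_isInducing x :=
    Topology.isInducing_const_prod.2 (L.isInducing x)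

instance : L.prebundle.IsContMDiff 𝓘(ℝ, EB) ∞ where
  exists_contMDiffCoordChange := by
    rintro _ ⟨i, rfl⟩ _ ⟨j, rfl⟩
    obtain ⟨c, hc, h⟩ := L.transition i j
    exact ⟨c, hc, fun x hx v => by rw [h x hx, L.pretriv_symm i hx.1]; rfl⟩

end LinearCharts
end LinearCharts

section ChainRule

variable {E₁ E₂ E₃ : Type*} [NormedAddCommGroup E₁] [NormedSpace ℝ E₁]
  [NormedAddCommGroup E₂] [NormedSpace ℝ E₂] [NormedAddCommGroup E₃] [NormedSpace ℝ E₃]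
  {H₁ H₂ H₃ : Type*} [TopologicalSpace H₁] [TopologicalSpace H₂] [TopologicalSpace H₃]
  {I₁ : ModelWithCorners ℝ E₁ H₁} {I₂ : ModelWithCorners ℝ E₂ H₂} {I₃ : ModelWithCorners ℝ E₃ H₃}
  {M₁ M₂ M₃ : Type*} [TopologicalSpace M₁] [ChartedSpace H₁ M₁]
  [TopologicalSpace M₂] [ChartedSpace H₂ M₂] [TopologicalSpace M₃] [ChartedSpace H₃ M₃]

lemma mfderiv_comp_model {f : M₁ → M₂} {g : M₂ → M₃} {h : M₁ → M₃} {x : M₁} {y : M₂}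
    (hg : MDifferentiableAt I₂ I₃ g y) (hf : MDifferentiableAt I₁ I₂ f x) (hy : f x = y)
    (e : g ∘ f =ᶠ[𝓝 x] h) (v : E₁) :
    ((mfderiv I₂ I₃ g y : E₂ →L[ℝ] E₃) ((mfderiv I₁ I₂ f x : E₁ →L[ℝ] E₂) v) : E₃) =
      (mfderiv I₁ I₃ h x : E₁ →L[ℝ] E₃) v := by
  subst hy
  have h1 := mfderiv_comp x hg hf
  rw [e.mfderiv_eq] at h1
  exact (congrArg (fun f : E₁ →L[ℝ] E₃ => f v) h1).symm

end ChainRule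

section PrincipalBundle

variable {EM : Type*} [NormedAddCommGroup EM] [NormedSpace ℝ EM]
  {EG : Type*} [NormedAddCommGroup EG] [NormedSpace ℝ EG]
  {EP : Type*} [NormedAddCommGroup EP] [NormedSpace ℝ EP]
  {M : Type*} [TopologicalSpace M] [ChartedSpace EM M]
  {G : Type*} [TopologicalSpace G] [ChartedSpace EG G] [Group G]
  {P : Type*} [TopologicalSpace P] [ChartedSpace EP P]

/-- A smooth principal `G`-bundle `p : P → M`: `p` is a surjective submersion and `G` acts smoothly
on the manifold `P` from the right, in such a way that `P × G → P ×_M P`, `(z, g) ↦ (z, z g)`, is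
well defined and a diffeomorphism. The last condition is expressed by its inverse
`(z, w) ↦ (z, τ(z, w))`, which is smooth on the submanifold `P ×_M P ⊆ P × P`. Here `EM`, `EG`, `EP`
are the model vector spaces of the manifolds `M`, `G`, `P`. -/
structure SmoothPrincipalBundle
    (EM : Type*) [NormedAddCommGroup EM] [NormedSpace ℝ EM]
    (EG : Type*) [NormedAddCommGroup EG] [NormedSpace ℝ EG]
    (EP : Type*) [NormedAddCommGroup EP] [NormedSpace ℝ EP]
    (M : Type*) [TopologicalSpace M] [ChartedSpace EM M]
    (G : Type*) [TopologicalSpace G] [ChartedSpace EG G] [Group G]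
    (P : Type*) [TopologicalSpace P] [ChartedSpace EP P] where
  proj : P → M
  act : P → G → P
  isSubmersion_proj : Manifold.IsSubmersion 𝓘(ℝ, EP) 𝓘(ℝ, EM) ∞ proj
  surjective_proj : Function.Surjective proj
  contMDiff_act : ContMDiff (𝓘(ℝ, EP).prod 𝓘(ℝ, EG)) 𝓘(ℝ, EP) ∞ (fun q : P × G => act q.1 q.2)
  act_one : ∀ z, act z 1 = z
  act_mul : ∀ z g h, act z (g * h) = act (act z g) h
  proj_act : ∀ z g, proj (act z g) = proj z
  exists_div : ∃ τ : P × P → G,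
    (∀ q : P × P, proj q.1 = proj q.2 → act q.1 (τ q) = q.2) ∧
    (∀ z g, τ (z, act z g) = g) ∧
    ContMDiffOn (𝓘(ℝ, EP).prod 𝓘(ℝ, EP)) 𝓘(ℝ, EG) ∞ τ {q | proj q.1 = proj q.2}

namespace SmoothPrincipalBundle

variable (E : SmoothPrincipalBundle EM EG EP M G P)

/-- The element `div z w` of `G` with `z (div z w) = w`, for `z`, `w` in the same fibre. -/
noncomputable def div (z w : P) : G := E.exists_div.choose (z, w)

lemma act_div {z w : P} (h : E.proj z = E.proj w) : E.act z (E.div z w) = w :=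
  E.exists_div.choose_spec.1 (z, w) h

lemma div_act (z : P) (g : G) : E.div z (E.act z g) = g :=
  E.exists_div.choose_spec.2.1 z g

lemma contMDiffOn_div : ContMDiffOn (𝓘(ℝ, EP).prod 𝓘(ℝ, EP)) 𝓘(ℝ, EG) ∞
    (fun q : P × P => E.div q.1 q.2) {q | E.proj q.1 = E.proj q.2} :=
  E.exists_div.choose_spec.2.2

lemma contMDiff_act_right (g : G) :
    ContMDiff 𝓘(ℝ, EP) 𝓘(ℝ, EP) ∞ (fun z => E.act z g) :=
  E.contMDiff_act.comp (contMDiff_id.prodMk contMDiff_const)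

lemma contMDiff_act_left (z : P) :
    ContMDiff 𝓘(ℝ, EG) 𝓘(ℝ, EP) ∞ (fun g => E.act z g) :=
  E.contMDiff_act.comp (contMDiff_const.prodMk contMDiff_id)

/-- The differential at `z` of the right translation by `g`, that is, the action of `g` on `TP`. -/
noncomputable def dR (g : G) (z : P) :
    TangentSpace 𝓘(ℝ, EP) z →L[ℝ] TangentSpace 𝓘(ℝ, EP) (E.act z g) :=
  mfderiv 𝓘(ℝ, EP) 𝓘(ℝ, EP) (fun w => E.act w g) z

/-- The fibre at `x` of the Atiyah bundle: `G`-invariant sections of `TP` along the fibre over `x`. -/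
def atSubmodule (x : M) : Submodule ℝ (∀ z : {z : P // E.proj z = x}, TangentSpace 𝓘(ℝ, EP) z.1) where
  carrier := {σ | ∀ (z : {z : P // E.proj z = x}) (g : G),
    σ ⟨E.act z.1 g, (E.proj_act z.1 g).trans z.2⟩ = E.dR g z.1 (σ z)}
  add_mem' {σ ρ} h k z g := by
    simp only [Pi.add_apply, h z g, k z g, map_add]
  zero_mem' z g := by simp
  smul_mem' c σ h z g := by
    simp only [Pi.smul_apply, h z g, map_smul]

lemma contMDiff_proj : ContMDiff 𝓘(ℝ, EP) 𝓘(ℝ, EM) ∞ E.proj := E.isSubmersion_proj.contMDiff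

/-- A smooth local section of the principal bundle. -/
structure LocalSection where
  dom : Set M
  isOpen_dom : IsOpen dom
  sec : M → P
  contMDiffOn_sec : ContMDiffOn 𝓘(ℝ, EM) 𝓘(ℝ, EP) ∞ sec dom
  proj_sec : ∀ x ∈ dom, E.proj (sec x) = x

lemma exists_localSection [IsManifold 𝓘(ℝ, EM) ∞ M] [IsManifold 𝓘(ℝ, EP) ∞ P] (x : M) :
    ∃ s : E.LocalSection, x ∈ s.dom := by
  obtain ⟨z, rfl⟩ := E.surjective_proj x
  obtain ⟨F, _, _, hF⟩ := E.isSubmersion_proj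
  have h := hF z
  set φ := h.domChart
  set ψ := h.codChart
  set e := h.equiv
  let c : F := (e (φ z)).2
  let lift : M → EP := fun y => e.symm (ψ y, c)
  have hlift : ContMDiffOn 𝓘(ℝ, EM) 𝓘(ℝ, EP) ∞ lift ψ.source := by
    have h1 : ContMDiffOn 𝓘(ℝ, EM) 𝓘(ℝ, EM) ∞ ψ ψ.source :=
      contMDiffOn_of_mem_maximalAtlas h.codChart_mem_maximalAtlas
    have h2 : ContMDiffOn 𝓘(ℝ, EM) 𝓘(ℝ, EM × F) ∞ (fun y => (ψ y, c)) ψ.source :=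
      h1.prodMk_space contMDiffOn_const
    exact e.symm.contDiff.contMDiff.comp_contMDiffOn h2
  have hwr : ∀ w ∈ φ.target, ψ (E.proj (φ.symm w)) = (e w).1 := by
    intro w hw
    have := h.writtenInCharts (show w ∈ (h.domChart.extend 𝓘(ℝ, EP)).target by simpa using hw)
    simpa using this
  have hz : z ∈ φ.source := h.mem_domChart_source
  have hpz : E.proj z ∈ ψ.source := h.mem_codChart_source
  have hl0 : lift (E.proj z) = φ z := by
    have := hwr (φ z) (φ.map_source hz)
    rw [φ.left_inv hz] at this
    simp only [lift, this, c]
    simp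
  refine ⟨⟨ψ.source ∩ lift ⁻¹' φ.target, ?_, fun y => φ.symm (lift y), ?_, ?_⟩, ?_⟩
  · exact hlift.continuousOn.isOpen_inter_preimage ψ.open_source φ.open_target
  · exact (contMDiffOn_symm_of_mem_maximalAtlas h.domChart_mem_maximalAtlas).comp
      (hlift.mono inter_subset_left) (fun y hy => hy.2)
  · intro y hy
    have h1 := hwr _ hy.2
    have h2 : φ.symm (lift y) ∈ φ.source := φ.map_target hy.2
    have h3 : E.proj (φ.symm (lift y)) ∈ ψ.source := h.source_subset_preimage_source h2
    refine ψ.injOn h3 hy.1 ?_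
    rw [h1]
    simp [lift]
  · refine ⟨hpz, ?_⟩
    simp only [mem_preimage, hl0]
    exact φ.map_source hz




lemma dR_one (z : P) (w : TangentSpace 𝓘(ℝ, EP) z) : (E.dR 1 z w : EP) = w := by
  have h : (fun w => E.act w 1) = id := funext E.act_one
  simp only [dR]
  rw [h, mfderiv_id]
  rfl

lemma dR_mul (g h : G) (z : P) (w : TangentSpace 𝓘(ℝ, EP) z) :
    (E.dR (g * h) z w : EP) = E.dR h (E.act z g) (E.dR g z w) := by
  have e : (fun w => E.act w (g * h)) = (fun w => E.act w h) ∘ (fun w => E.act w g) :=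
    funext fun w => E.act_mul w g h
  simp only [dR]
  rw [e, mfderiv_comp z (((E.contMDiff_act_right h) _).mdifferentiableAt (by simp))
    (((E.contMDiff_act_right g) _).mdifferentiableAt (by simp))]
  rfl

variable {E} in
lemma at_apply {x : M} (σ : E.atSubmodule x) {z z' : P} (h : E.proj z = x) (h' : E.proj z' = x)
    (g : G) (e : E.act z g = z') : (σ.1 ⟨z', h'⟩ : EP) = E.dR g z (σ.1 ⟨z, h⟩) := by
  subst e
  exact σ.2 ⟨z, h⟩ g

lemma div_act_act {z w : P} (h : E.proj z = E.proj w) (g : G) :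
    E.div z (E.act w g) = E.div z w * g := by
  conv_lhs => rw [← E.act_div h, ← E.act_mul, E.div_act]

lemma div_self (z : P) : E.div z z = 1 := by
  conv_lhs => rw [← E.act_one z]
  rw [E.act_one, ← E.div_act z 1, E.act_one]

lemma dR_congr {g g' : G} {z z' : P} (hg : g = g') (hz : z = z') (w : EP) :
    (E.dR g z w : EP) = E.dR g' z' w := by
  subst hg hz
  rfl

/-- Evaluation of an invariant section at a point of the fibre. -/
noncomputable def ev {x : M} {z : P} (h : E.proj z = x) :
    E.atSubmodule x ≃ₗ[ℝ] TangentSpace 𝓘(ℝ, EP) z where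
  toFun σ := σ.1 ⟨z, h⟩
  map_add' _ _ := rfl
  map_smul' _ _ := rfl
  invFun w := ⟨fun z' => E.dR (E.div z z'.1) z w, by
    intro z' g
    have h1 := E.div_act_act (h.trans z'.2.symm) g
    have h2 := E.dR_mul (E.div z z'.1) g z w
    have h3 := E.dR_congr (g := g) rfl (E.act_div (h.trans z'.2.symm)) (E.dR (E.div z z'.1) z w)
    exact (E.dR_congr h1 rfl w).trans (h2.trans h3)⟩
  left_inv σ := by
    refine Subtype.ext (funext fun z' => ?_)
    exact (at_apply σ h z'.2 _ (E.act_div (h.trans z'.2.symm))).symm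
  right_inv w := (E.dR_congr (E.div_self z) rfl w).trans (E.dR_one z w)

lemma ev_symm_apply {x : M} {z z' : P} (h : E.proj z = x) (h' : E.proj z' = x) (w : EP) :
    (((E.ev h).symm w).1 ⟨z', h'⟩ : EP) = E.dR (E.div z z') z w := rfl

lemma mfderiv_proj_dR (g : G) (z : P) (w : EP) :
    (mfderiv 𝓘(ℝ, EP) 𝓘(ℝ, EM) E.proj (E.act z g) (E.dR g z w) : EM) =
      mfderiv 𝓘(ℝ, EP) 𝓘(ℝ, EM) E.proj z w := by
  have e : E.proj = E.proj ∘ (fun w => E.act w g) := funext fun w => (E.proj_act w g).symm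
  have h := mfderiv_comp (I' := 𝓘(ℝ, EP)) z ((E.contMDiff_proj _).mdifferentiableAt (by simp))
    (((E.contMDiff_act_right g) z).mdifferentiableAt (by simp))
  rw [← e] at h
  rw [h]
  rfl


/-- The fibre `At(E)_x` of the Atiyah bundle `At(E) = TP / G`. -/
def At (x : M) : Type _ := E.atSubmodule x

noncomputable instance (x : M) : AddCommGroup (E.At x) := inferInstanceAs (AddCommGroup (E.atSubmodule x))
noncomputable instance (x : M) : Module ℝ (E.At x) := inferInstanceAs (Module ℝ (E.atSubmodule x))
instance (x : M) : TopologicalSpace (E.At x) := inferInstanceAs (TopologicalSpace (E.atSubmodule x))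
instance (x : M) : IsTopologicalAddGroup (E.At x) :=
  inferInstanceAs (IsTopologicalAddGroup (E.atSubmodule x))
instance (x : M) : ContinuousSMul ℝ (E.At x) := inferInstanceAs (ContinuousSMul ℝ (E.atSubmodule x))

/-- The map `η : At(E)_x → T_x M` induced by the differential of the projection. It does not depend
on the point of the fibre at which it is computed, see `anchor_apply`. -/
noncomputable def anchor (x : M) : E.At x →L[ℝ] TangentSpace 𝓘(ℝ, EM) x where
  toFun σ := mfderiv 𝓘(ℝ, EP) 𝓘(ℝ, EM) E.proj (E.surjective_proj x).choose
    (σ.1 ⟨_, (E.surjective_proj x).choose_spec⟩)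
  map_add' _ _ := (mfderiv 𝓘(ℝ, EP) 𝓘(ℝ, EM) E.proj _).map_add _ _
  map_smul' c _ := (mfderiv 𝓘(ℝ, EP) 𝓘(ℝ, EM) E.proj _).map_smul c _
  cont := (mfderiv 𝓘(ℝ, EP) 𝓘(ℝ, EM) E.proj _).continuous.comp
    ((continuous_apply _).comp continuous_subtype_val)

lemma anchor_apply
    {x : M} (σ : E.At x) {z : P} (h : E.proj z = x) :
    (E.anchor x σ : EM) = mfderiv 𝓘(ℝ, EP) 𝓘(ℝ, EM) E.proj z (σ.1 ⟨z, h⟩) := by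
  have h0 := (E.surjective_proj x).choose_spec
  set z0 := (E.surjective_proj x).choose
  have e := E.act_div (h0.trans h.symm)
  have h1 := at_apply σ h0 h _ e
  have h2 := E.mfderiv_proj_dR (E.div z0 z) z0 (σ.1 ⟨z0, h0⟩)
  rw [e] at h2
  change _ = (mfderiv 𝓘(ℝ, EP) 𝓘(ℝ, EM) E.proj z : EP →L[ℝ] EM) (σ.1 ⟨z, h⟩ : EP)
  rw [h1]
  exact h2.symm


/-- The subspace `ad(E)_x ⊆ At(E)_x` of invariant sections with values in `ker(dp)`. -/
def adSubmodule (x : M) : Submodule ℝ (E.At x) where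
  carrier := {σ | ∀ z : {z : P // E.proj z = x},
    mfderiv 𝓘(ℝ, EP) 𝓘(ℝ, EM) E.proj z.1 (σ.1 z) = 0}
  add_mem' {σ ρ} h k z := by
    have := (mfderiv 𝓘(ℝ, EP) 𝓘(ℝ, EM) E.proj z.1).map_add (σ.1 z) (ρ.1 z)
    rw [h z, k z, add_zero] at this
    exact this
  zero_mem' z := (mfderiv 𝓘(ℝ, EP) 𝓘(ℝ, EM) E.proj z.1).map_zero
  smul_mem' c σ h z := by
    have := (mfderiv 𝓘(ℝ, EP) 𝓘(ℝ, EM) E.proj z.1).map_smul c (σ.1 z)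
    rw [h z, smul_zero] at this
    exact this

lemma mem_adSubmodule_iff {x : M} (σ : E.At x) : σ ∈ E.adSubmodule x ↔ E.anchor x σ = 0 := by
  constructor
  · intro h
    exact h ⟨_, (E.surjective_proj x).choose_spec⟩
  · rintro h ⟨z, hz⟩
    exact (E.anchor_apply σ hz).symm.trans h

/-- The fibre `ad(E)_x` of the adjoint bundle `ad(E) = ker(dp) / G`. -/
def Ad (x : M) : Type _ := E.adSubmodule x

noncomputable instance (x : M) : AddCommGroup (E.Ad x) :=
  inferInstanceAs (AddCommGroup (E.adSubmodule x))
noncomputable instance (x : M) : Module ℝ (E.Ad x) := inferInstanceAs (Module ℝ (E.adSubmodule x))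
instance (x : M) : TopologicalSpace (E.Ad x) := inferInstanceAs (TopologicalSpace (E.adSubmodule x))
instance (x : M) : IsTopologicalAddGroup (E.Ad x) :=
  inferInstanceAs (IsTopologicalAddGroup (E.adSubmodule x))
instance (x : M) : ContinuousSMul ℝ (E.Ad x) := inferInstanceAs (ContinuousSMul ℝ (E.adSubmodule x))

/-- The inclusion `ι₀ : ad(E)_x → At(E)_x`. -/
noncomputable def adIncl (x : M) : E.Ad x →L[ℝ] E.At x := (E.adSubmodule x).subtypeL

lemma anchor_adIncl (x : M) (σ : E.Ad x) : E.anchor x (E.adIncl x σ) = 0 :=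
  (E.mem_adSubmodule_iff _).1 σ.2

open TensorProduct in
/-- Under the canonical identification `V ⊗ T_x^*M = Hom(T_x M, V)`, `v ⊗ ℓ ↦ (u ↦ ℓ(u) v)`, the
map `η ⊗ Id` is composition with `η`. -/
lemma anchor_rTensor (x : M) (t : E.At x ⊗[ℝ] Module.Dual ℝ (TangentSpace 𝓘(ℝ, EM) x)) :
    dualTensorHom ℝ (TangentSpace 𝓘(ℝ, EM) x) (TangentSpace 𝓘(ℝ, EM) x)
      (TensorProduct.comm ℝ _ _ (LinearMap.rTensor _ (E.anchor x).toLinearMap t)) =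
    (E.anchor x).toLinearMap ∘ₗ dualTensorHom ℝ (TangentSpace 𝓘(ℝ, EM) x) (E.At x)
      (TensorProduct.comm ℝ _ _ t) := by
  induction t with
  | zero => simp
  | tmul σ l => ext u; simp
  | add a b ha hb => simp only [map_add, ha, hb, LinearMap.comp_add]

namespace LocalSection

variable {E} (s : E.LocalSection)

/-- The fibre coordinate `κ` of the local trivialization given by the section `s`:
`z = s(p(z)) κ(z)`. -/
noncomputable def fib (z : P) : G := E.div (s.sec (E.proj z)) z

lemma act_fib {z : P} (h : E.proj z ∈ s.dom) : E.act (s.sec (E.proj z)) (s.fib z) = z :=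
  E.act_div (s.proj_sec _ h)

lemma fib_act {x : M} (hx : x ∈ s.dom) (g : G) : s.fib (E.act (s.sec x) g) = g := by
  rw [fib, E.proj_act, s.proj_sec x hx, E.div_act]

lemma fib_sec {x : M} (hx : x ∈ s.dom) : s.fib (s.sec x) = 1 := by
  rw [← s.fib_act hx 1, E.act_one]

lemma contMDiffAt_sec {x : M} (hx : x ∈ s.dom) :
    ContMDiffAt 𝓘(ℝ, EM) 𝓘(ℝ, EP) ∞ s.sec x :=
  s.contMDiffOn_sec.contMDiffAt (s.isOpen_dom.mem_nhds hx)

lemma contMDiffAt_fib {z : P} (h : E.proj z ∈ s.dom) :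
    ContMDiffAt 𝓘(ℝ, EP) 𝓘(ℝ, EG) ∞ s.fib z := by
  have ho : IsOpen (E.proj ⁻¹' s.dom) := s.isOpen_dom.preimage E.contMDiff_proj.continuous
  have h1 : ContMDiffOn 𝓘(ℝ, EP) 𝓘(ℝ, EP) ∞ (fun w => s.sec (E.proj w)) (E.proj ⁻¹' s.dom) :=
    s.contMDiffOn_sec.comp E.contMDiff_proj.contMDiffOn (fun w hw => hw)
  have h2 := E.contMDiffOn_div.comp (h1.prodMk contMDiffOn_id)
    (fun w (hw : E.proj w ∈ s.dom) => s.proj_sec _ hw)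
  exact h2.contMDiffAt (ho.mem_nhds h)

/-- The differential of the section. -/
noncomputable def dsec (x : M) : EM →L[ℝ] EP := mfderiv 𝓘(ℝ, EM) 𝓘(ℝ, EP) s.sec x

/-- The differential of the fibre coordinate along the section. -/
noncomputable def dfib (x : M) : EP →L[ℝ] EG := mfderiv 𝓘(ℝ, EP) 𝓘(ℝ, EG) s.fib (s.sec x)

/-- The infinitesimal action `𝔤 → T_{s(x)} P`. -/
noncomputable def dorb (x : M) : EG →L[ℝ] EP :=
  mfderiv 𝓘(ℝ, EG) 𝓘(ℝ, EP) (fun g : G => E.act (s.sec x) g) 1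

/-- The differential of the projection along the section. -/
noncomputable def dproj (x : M) : EP →L[ℝ] EM := mfderiv 𝓘(ℝ, EP) 𝓘(ℝ, EM) E.proj (s.sec x)

variable {s} {x : M}

lemma proj_sec_mem (hx : x ∈ s.dom) : E.proj (s.sec x) ∈ s.dom := (s.proj_sec x hx).symm ▸ hx

lemma mdifferentiableAt_fib (hx : x ∈ s.dom) :
    MDifferentiableAt 𝓘(ℝ, EP) 𝓘(ℝ, EG) s.fib (s.sec x) :=
  (s.contMDiffAt_fib (proj_sec_mem hx)).mdifferentiableAt (by simp)

lemma mdifferentiableAt_sec (hx : x ∈ s.dom) : MDifferentiableAt 𝓘(ℝ, EM) 𝓘(ℝ, EP) s.sec x :=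
  (s.contMDiffAt_sec hx).mdifferentiableAt (by simp)

lemma mdifferentiableAt_proj (z : P) : MDifferentiableAt 𝓘(ℝ, EP) 𝓘(ℝ, EM) E.proj z :=
  (E.contMDiff_proj z).mdifferentiableAt (by simp)

lemma mdifferentiableAt_orb (z : P) (g : G) :
    MDifferentiableAt 𝓘(ℝ, EG) 𝓘(ℝ, EP) (fun g : G => E.act z g) g :=
  (E.contMDiff_act_left z g).mdifferentiableAt (by simp)

lemma dproj_dsec (hx : x ∈ s.dom) (v : EM) : s.dproj x (s.dsec x v) = v := by
  have e : E.proj ∘ s.sec =ᶠ[𝓝 x] id := by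
    filter_upwards [s.isOpen_dom.mem_nhds hx] with y hy using s.proj_sec y hy
  refine (mfderiv_comp_model (mdifferentiableAt_proj _) (mdifferentiableAt_sec hx) rfl e v).trans ?_
  rw [mfderiv_id]
  rfl

lemma dproj_dorb (X : EG) : s.dproj x (s.dorb x X) = 0 := by
  have e : E.proj ∘ (fun g : G => E.act (s.sec x) g) = fun _ => E.proj (s.sec x) :=
    funext fun g => E.proj_act _ g
  refine (mfderiv_comp_model (mdifferentiableAt_proj _) (mdifferentiableAt_orb _ 1) (E.act_one _)
    (Filter.EventuallyEq.of_eq e) X).trans ?_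
  rw [mfderiv_const]
  rfl

lemma dfib_dsec (hx : x ∈ s.dom) (v : EM) : s.dfib x (s.dsec x v) = 0 := by
  have e : s.fib ∘ s.sec =ᶠ[𝓝 x] fun _ => 1 := by
    filter_upwards [s.isOpen_dom.mem_nhds hx] with y hy using s.fib_sec hy
  refine (mfderiv_comp_model (mdifferentiableAt_fib hx) (mdifferentiableAt_sec hx) rfl e v).trans ?_
  rw [mfderiv_const]
  rfl

lemma dfib_dorb (hx : x ∈ s.dom) (X : EG) : s.dfib x (s.dorb x X) = X := by
  have e : s.fib ∘ (fun g : G => E.act (s.sec x) g) = id := funext fun g => s.fib_act hx g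
  refine (mfderiv_comp_model (mdifferentiableAt_fib hx) (mdifferentiableAt_orb _ 1) (E.act_one _)
    (Filter.EventuallyEq.of_eq e) X).trans ?_
  rw [mfderiv_id]
  rfl

lemma dsec_dproj_add (hx : x ∈ s.dom) (w : EP) :
    s.dsec x (s.dproj x w) + s.dorb x (s.dfib x w) = w := by
  have hact : MDifferentiableAt (𝓘(ℝ, EP).prod 𝓘(ℝ, EG)) 𝓘(ℝ, EP)
      (fun q : P × G => E.act q.1 q.2) (s.sec x, 1) :=
    (E.contMDiff_act _).mdifferentiableAt (by simp)
  have hsp : MDifferentiableAt 𝓘(ℝ, EP) 𝓘(ℝ, EP) (s.sec ∘ E.proj) (s.sec x) :=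
    MDifferentiableAt.comp (s.sec x) (mdifferentiableAt_sec (proj_sec_mem hx))
      (mdifferentiableAt_proj _)
  have hfib := mdifferentiableAt_fib hx
  have hpair : ((s.sec ∘ E.proj) (s.sec x), s.fib (s.sec x)) = (s.sec x, (1 : G)) := by
    simp only [Function.comp, s.proj_sec x hx, s.fib_sec hx]
  have e : (fun q : P × G => E.act q.1 q.2) ∘ (fun z => ((s.sec ∘ E.proj) z, s.fib z))
      =ᶠ[𝓝 (s.sec x)] id := by
    have ho : IsOpen (E.proj ⁻¹' s.dom) := s.isOpen_dom.preimage E.contMDiff_proj.continuous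
    filter_upwards [ho.mem_nhds (proj_sec_mem hx)] with y hy using s.act_fib hy
  have h := mfderiv_comp_model hact (hsp.prodMk hfib) hpair e w
  rw [hsp.mfderiv_prod hfib, mfderiv_id] at h
  have h4 : (mfderiv 𝓘(ℝ, EP) 𝓘(ℝ, EP) (s.sec ∘ E.proj) (s.sec x) : EP →L[ℝ] EP) w =
      s.dsec x (s.dproj x w) :=
    (mfderiv_comp_model (mdifferentiableAt_sec hx) (mdifferentiableAt_proj _)
      (s.proj_sec x hx) Filter.EventuallyEq.rfl w).symm
  have h3 := mfderiv_prod_eq_add_apply (v := ((s.dsec x (s.dproj x w) : EP), (s.dfib x w : EG))) hact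
  have h5 (u : EP) : (mfderiv 𝓘(ℝ, EP) 𝓘(ℝ, EP) (fun z => E.act z 1) (s.sec x) : EP →L[ℝ] EP) u
      = u := E.dR_one (s.sec x) u
  refine (congrArg (· + s.dorb x (s.dfib x w)) (h5 _).symm).trans (h3.symm.trans (Eq.trans ?_ h))
  rw [← h4]
  rfl

/-- The transition function `γ` between two local sections: `s'(x) = s(x) γ(x)`. -/
noncomputable def trans (s s' : E.LocalSection) (x : M) : G := E.div (s.sec x) (s'.sec x)

variable {s' : E.LocalSection}

lemma act_trans (hx : x ∈ s.dom) (hx' : x ∈ s'.dom) : E.act (s.sec x) (s.trans s' x) = s'.sec x :=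
  E.act_div ((s.proj_sec x hx).trans (s'.proj_sec x hx').symm)

lemma contMDiffAt_trans (hx : x ∈ s.dom) (hx' : x ∈ s'.dom) :
    ContMDiffAt 𝓘(ℝ, EM) 𝓘(ℝ, EG) ∞ (s.trans s') x := by
  have h := E.contMDiffOn_div.comp ((s.contMDiffOn_sec.mono inter_subset_left).prodMk
    (s'.contMDiffOn_sec.mono inter_subset_right))
    (fun y (hy : y ∈ s.dom ∩ s'.dom) => (s.proj_sec y hy.1).trans (s'.proj_sec y hy.2).symm)
  exact h.contMDiffAt ((s.isOpen_dom.inter s'.isOpen_dom).mem_nhds ⟨hx, hx'⟩)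

/-- The linear isomorphism `At(E)_x ≅ T_x M × 𝔤` defined by a local section. -/
noncomputable def atEquiv (hx : x ∈ s.dom) : E.At x ≃ₗ[ℝ] EM × EG where
  toFun σ := (E.anchor x σ, s.dfib x (E.ev (s.proj_sec x hx) σ))
  map_add' σ ρ := by
    rw [map_add (E.anchor x)]
    have h : E.ev (s.proj_sec x hx) (σ + ρ) = E.ev (s.proj_sec x hx) σ + E.ev (s.proj_sec x hx) ρ :=
      map_add _ _ _
    exact Prod.ext rfl ((congrArg (s.dfib x) h).trans ((s.dfib x).map_add _ _))
  map_smul' c σ := by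
    rw [map_smul (E.anchor x)]
    have h : E.ev (s.proj_sec x hx) (c • σ) = c • E.ev (s.proj_sec x hx) σ :=
      map_smul _ _ _
    exact Prod.ext rfl ((congrArg (s.dfib x) h).trans ((s.dfib x).map_smul _ _))
  invFun q := (E.ev (s.proj_sec x hx)).symm (s.dsec x q.1 + s.dorb x q.2 : EP)
  left_inv σ := by
    have h1 : (E.anchor x σ : EM) = s.dproj x (E.ev (s.proj_sec x hx) σ) :=
      E.anchor_apply σ (s.proj_sec x hx)
    refine (E.ev (s.proj_sec x hx)).injective ?_
    refine ((E.ev (s.proj_sec x hx)).apply_symm_apply _).trans ?_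
    refine (congrArg (fun u : EM => (s.dsec x u + s.dorb x (s.dfib x
      (E.ev (s.proj_sec x hx) σ)) : EP)) h1).trans ?_
    exact dsec_dproj_add hx _
  right_inv q := by
    set σ : E.At x := (E.ev (s.proj_sec x hx)).symm (s.dsec x q.1 + s.dorb x q.2 : EP) with hσ
    have h0 : (E.ev (s.proj_sec x hx) σ : EP) = s.dsec x q.1 + s.dorb x q.2 :=
      (E.ev (s.proj_sec x hx)).apply_symm_apply _
    have h1 : (E.anchor x σ : EM) = s.dproj x (E.ev (s.proj_sec x hx) σ) :=
      E.anchor_apply σ (s.proj_sec x hx)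
    refine Prod.ext ?_ ?_
    · refine h1.trans ((congrArg (s.dproj x) h0).trans ?_)
      rw [map_add, dproj_dsec hx, dproj_dorb, add_zero]
    · refine (congrArg (s.dfib x) h0).trans ?_
      rw [map_add, dfib_dsec hx, dfib_dorb hx, zero_add]

lemma ev_atEquiv_symm (hx : x ∈ s.dom) (q : EM × EG) :
    (E.ev (s.proj_sec x hx) ((atEquiv hx).symm q) : EP) = s.dsec x q.1 + s.dorb x q.2 :=
  (E.ev (s.proj_sec x hx)).apply_symm_apply _

/-- The `TM → 𝔤` part of the change of trivialization. -/
noncomputable def transMC (s s' : E.LocalSection) (x : M) : EM →L[ℝ] EG :=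
  mfderiv 𝓘(ℝ, EM) 𝓘(ℝ, EG) (fun y => (s.trans s' y)⁻¹ * s.trans s' x) x

/-- The `𝔤 → 𝔤` part of the change of trivialization, the adjoint action of `γ(x)⁻¹`. -/
noncomputable def transAd (s s' : E.LocalSection) (x : M) : EG →L[ℝ] EG :=
  mfderiv 𝓘(ℝ, EG) 𝓘(ℝ, EG) (fun h => (s.trans s' x)⁻¹ * h * s.trans s' x) 1

lemma mdifferentiableAt_act (g : G) (z : P) :
    MDifferentiableAt 𝓘(ℝ, EP) 𝓘(ℝ, EP) (fun z => E.act z g) z :=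
  (E.contMDiff_act_right g z).mdifferentiableAt (by simp)

lemma dfib_dR_dsec (hx : x ∈ s.dom) (hx' : x ∈ s'.dom) (v : EM) :
    s'.dfib x (E.dR (s.trans s' x) (s.sec x) (s.dsec x v) : EP) = transMC s s' x v := by
  have e1 := mfderiv_comp_model (mdifferentiableAt_act (E := E) (s.trans s' x) (s.sec x))
    (mdifferentiableAt_sec hx) rfl Filter.EventuallyEq.rfl v
  have hd : MDifferentiableAt 𝓘(ℝ, EM) 𝓘(ℝ, EP)
      ((fun z => E.act z (s.trans s' x)) ∘ s.sec) x :=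
    (mdifferentiableAt_act (s.trans s' x) (s.sec x)).comp x (mdifferentiableAt_sec hx)
  have e : s'.fib ∘ ((fun z => E.act z (s.trans s' x)) ∘ s.sec) =ᶠ[𝓝 x]
      (fun y => (s.trans s' y)⁻¹ * s.trans s' x) := by
    filter_upwards [s.isOpen_dom.mem_nhds hx, s'.isOpen_dom.mem_nhds hx'] with y hy hy'
    have h : s.sec y = E.act (s'.sec y) (s.trans s' y)⁻¹ := by
      rw [← act_trans hy hy', ← E.act_mul, mul_inv_cancel, E.act_one]
    simp only [Function.comp]
    rw [h, ← E.act_mul, s'.fib_act hy']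
  have e2 := mfderiv_comp_model (mdifferentiableAt_fib hx') hd (act_trans hx hx') e v
  refine Eq.trans ?_ e2
  exact congrArg (s'.dfib x) e1

lemma dfib_dR_dorb (hx : x ∈ s.dom) (hx' : x ∈ s'.dom) (X : EG) :
    s'.dfib x (E.dR (s.trans s' x) (s.sec x) (s.dorb x X) : EP) = transAd s s' x X := by
  have e1 := mfderiv_comp_model (mdifferentiableAt_act (E := E) (s.trans s' x) (s.sec x))
    (mdifferentiableAt_orb (s.sec x) 1) (E.act_one _) Filter.EventuallyEq.rfl X
  have hd : MDifferentiableAt 𝓘(ℝ, EG) 𝓘(ℝ, EP)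
      ((fun z => E.act z (s.trans s' x)) ∘ (fun g : G => E.act (s.sec x) g)) 1 :=
    (mdifferentiableAt_act (s.trans s' x) _).comp 1 (mdifferentiableAt_orb (s.sec x) 1)
  have e : s'.fib ∘ ((fun z => E.act z (s.trans s' x)) ∘ (fun g : G => E.act (s.sec x) g)) =
      (fun h => (s.trans s' x)⁻¹ * h * s.trans s' x) := by
    funext h
    have hs : s.sec x = E.act (s'.sec x) (s.trans s' x)⁻¹ := by
      rw [← act_trans hx hx', ← E.act_mul, mul_inv_cancel, E.act_one]
    simp only [Function.comp]
    rw [hs, ← E.act_mul, ← E.act_mul, s'.fib_act hx', mul_assoc]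
  have e2 := mfderiv_comp_model (mdifferentiableAt_fib hx') hd
    (by simp only [Function.comp, E.act_one, act_trans hx hx'])
    (Filter.EventuallyEq.of_eq e) X
  refine Eq.trans ?_ e2
  exact congrArg (s'.dfib x) e1

lemma atEquiv_atEquiv_symm (hx : x ∈ s.dom) (hx' : x ∈ s'.dom) (q : EM × EG) :
    atEquiv hx' ((atEquiv hx).symm q) = (q.1, transMC s s' x q.1 + transAd s s' x q.2) := by
  set σ := (atEquiv hx).symm q with hσ
  have h0 : (E.ev (s.proj_sec x hx) σ : EP) = s.dsec x q.1 + s.dorb x q.2 :=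
    ev_atEquiv_symm hx q
  have h1 : (E.ev (s'.proj_sec x hx') σ : EP) =
      E.dR (s.trans s' x) (s.sec x) (E.ev (s.proj_sec x hx) σ : EP) :=
    at_apply σ (s.proj_sec x hx) (s'.proj_sec x hx') _ (act_trans hx hx')
  refine Prod.ext ?_ ?_
  · have h := congrArg Prod.fst ((atEquiv hx).apply_symm_apply q)
    exact h
  · refine (congrArg (s'.dfib x) h1).trans ?_
    refine (congrArg (fun w : EP => s'.dfib x (E.dR (s.trans s' x) (s.sec x) w : EP)) h0).trans ?_
    have h2 : (E.dR (s.trans s' x) (s.sec x) (s.dsec x q.1 + s.dorb x q.2 : EP) : EP) =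
      E.dR (s.trans s' x) (s.sec x) (s.dsec x q.1) + E.dR (s.trans s' x) (s.sec x) (s.dorb x q.2) :=
      (E.dR (s.trans s' x) (s.sec x)).map_add _ _
    refine (congrArg (s'.dfib x) h2).trans ?_
    exact ((s'.dfib x).map_add _ _).trans
      (congrArg₂ (· + ·) (dfib_dR_dsec hx hx' q.1) (dfib_dR_dorb hx hx' q.2))

section Smoothness

variable [IsManifold 𝓘(ℝ, EM) ∞ M]

/-- The tangent bundle coordinates of `M` around `x₀`, at the point `x`. -/
noncomputable def tmCoord (x₀ x : M) : EM →L[ℝ] EM :=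
  (trivializationAt EM (TangentSpace 𝓘(ℝ, EM)) x₀).continuousLinearMapAt ℝ x

/-- The inverse tangent bundle coordinates of `M` around `x₀`, at the point `x`. -/
noncomputable def tmInv (x₀ x : M) : EM →L[ℝ] EM :=
  (trivializationAt EM (TangentSpace 𝓘(ℝ, EM)) x₀).symmL ℝ x

lemma tmInv_tmCoord {x₀ x : M} (hx : x ∈ (trivializationAt EM (TangentSpace 𝓘(ℝ, EM)) x₀).baseSet)
    (v : EM) : tmInv x₀ x (tmCoord x₀ x v) = v :=
  (trivializationAt EM (TangentSpace 𝓘(ℝ, EM)) x₀).symmL_continuousLinearMapAt hx v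

lemma tmCoord_tmInv {x₀ x : M} (hx : x ∈ (trivializationAt EM (TangentSpace 𝓘(ℝ, EM)) x₀).baseSet)
    (v : EM) : tmCoord x₀ x (tmInv x₀ x v) = v :=
  (trivializationAt EM (TangentSpace 𝓘(ℝ, EM)) x₀).continuousLinearMapAt_symmL hx v

lemma contMDiffAt_tmCoord_tmInv {x₀ x₁ x : M}
    (hx : x ∈ (trivializationAt EM (TangentSpace 𝓘(ℝ, EM)) x₀).baseSet)
    (hx' : x ∈ (trivializationAt EM (TangentSpace 𝓘(ℝ, EM)) x₁).baseSet) :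
    ContMDiffAt 𝓘(ℝ, EM) 𝓘(ℝ, EM →L[ℝ] EM) ∞
      (fun y => (tmCoord x₁ y : EM →L[ℝ] EM) ∘L (tmInv x₀ y : EM →L[ℝ] EM)) x := by
  set e := trivializationAt EM (TangentSpace 𝓘(ℝ, EM)) x₀
  set e' := trivializationAt EM (TangentSpace 𝓘(ℝ, EM)) x₁
  refine (contMDiffAt_coordChangeL (e := e) (e' := e') (n := ∞) (IB := 𝓘(ℝ, EM)) hx hx').congr_of_eventuallyEq ?_
  filter_upwards [(e.open_baseSet.inter e'.open_baseSet).mem_nhds ⟨hx, hx'⟩] with y hy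
  ext v
  have h := e.coordChangeL_apply (R := ℝ) e' hy v
  rw [ContinuousLinearEquiv.coe_coe, h]
  refine Eq.trans ?_ (e'.continuousLinearMapAt_apply_of_mem ℝ hy.2 (e.symm y v))
  exact congrArg (e'.continuousLinearMapAt ℝ y) (e.symmL_apply hy.1 v)

lemma tangent_coord_self {E' : Type*} [NormedAddCommGroup E'] [NormedSpace ℝ E'] {N : Type*}
    [TopologicalSpace N] [ChartedSpace E' N] [IsManifold 𝓘(ℝ, E') 1 N] (b : N) (v : E') :
    ((trivializationAt E' (TangentSpace 𝓘(ℝ, E')) b).continuousLinearMapAt ℝ b v : E') = v := by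
  have h := TangentBundle.continuousLinearMapAt_trivializationAt_eq_core (I := 𝓘(ℝ, E'))
    (b₀ := b) (b := b) (mem_chart_source E' b)
  refine (congrArg (fun f : E' →L[ℝ] E' => f v) h).trans ?_
  exact (tangentBundleCore 𝓘(ℝ, E') N).coordChange_self _ _ (mem_achart_source E' b) v

lemma tangent_coordSymm_self {E' : Type*} [NormedAddCommGroup E'] [NormedSpace ℝ E'] {N : Type*}
    [TopologicalSpace N] [ChartedSpace E' N] [IsManifold 𝓘(ℝ, E') 1 N] (b : N) (v : E') :
    ((trivializationAt E' (TangentSpace 𝓘(ℝ, E')) b).symmL ℝ b v : E') = v := by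
  have h := TangentBundle.symmL_trivializationAt_eq_core (I := 𝓘(ℝ, E'))
    (b₀ := b) (b := b) (mem_chart_source E' b)
  refine (congrArg (fun f : E' →L[ℝ] E' => f v) h).trans ?_
  exact (tangentBundleCore 𝓘(ℝ, E') N).coordChange_self _ _ (mem_achart_source E' b) v

lemma inTangentCoordinates_apply {E₁ E' : Type*} [NormedAddCommGroup E₁] [NormedSpace ℝ E₁]
    [NormedAddCommGroup E'] [NormedSpace ℝ E'] {N N' B : Type*}
    [TopologicalSpace N] [ChartedSpace E₁ N] [IsManifold 𝓘(ℝ, E₁) 1 N]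
    [TopologicalSpace N'] [ChartedSpace E' N'] [IsManifold 𝓘(ℝ, E') 1 N']
    (f : B → N) (g : B → N') (φ : B → E₁ →L[ℝ] E') (b₀ b : B) (h : g b = g b₀) (v : E₁) :
    inTangentCoordinates 𝓘(ℝ, E₁) 𝓘(ℝ, E') f g φ b₀ b v =
      φ b ((trivializationAt E₁ (TangentSpace 𝓘(ℝ, E₁)) (f b₀)).symmL ℝ (f b) v : E₁) := by
  have key : ∀ (y₀ y : N') (_ : y = y₀) (w : E'),
      ((trivializationAt E' (TangentSpace 𝓘(ℝ, E')) y₀).continuousLinearMapAt ℝ y w : E') = w := by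
    rintro y₀ y rfl w
    exact tangent_coord_self (E' := E') y w
  exact key (g b₀) (g b) h _

lemma contMDiffAt_transAd [LieGroup 𝓘(ℝ, EG) ∞ G] (hx : x ∈ s.dom) (hx' : x ∈ s'.dom) :
    ContMDiffAt 𝓘(ℝ, EM) 𝓘(ℝ, EG →L[ℝ] EG) ∞ (transAd s s') x := by
  have hγ := contMDiffAt_trans hx hx'
  have hf : ContMDiffAt (𝓘(ℝ, EM).prod 𝓘(ℝ, EG)) 𝓘(ℝ, EG) ∞
      (Function.uncurry fun (y : M) (h : G) => (s.trans s' y)⁻¹ * h * s.trans s' y) (x, 1) := by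
    have h1 : ContMDiffAt (𝓘(ℝ, EM).prod 𝓘(ℝ, EG)) 𝓘(ℝ, EG) ∞
      (fun q : M × G => s.trans s' q.1) (x, 1) := ContMDiffAt.comp (g := s.trans s') (x, (1 : G)) hγ contMDiffAt_fst
    exact (h1.inv.mul contMDiffAt_snd).mul h1
  have h : ContMDiffAt 𝓘(ℝ, EM) 𝓘(ℝ, EG →L[ℝ] EG) ∞ (inTangentCoordinates 𝓘(ℝ, EG) 𝓘(ℝ, EG)
      (fun _ : M => (1 : G)) (fun y => (s.trans s' y)⁻¹ * 1 * s.trans s' y) (transAd s s') x) x :=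
    ContMDiffAt.mfderiv (m := ∞) (fun (y : M) (h : G) => (s.trans s' y)⁻¹ * h * s.trans s' y)
      (fun _ : M => (1 : G)) hf contMDiffAt_const (by simp)
  refine h.congr_of_eventuallyEq (Filter.Eventually.of_forall fun y => ?_)
  ext X
  have h4 := inTangentCoordinates_apply (fun _ : M => (1 : G))
    (fun y => (s.trans s' y)⁻¹ * 1 * s.trans s' y) (transAd s s') x y (by simp) X
  rw [h4]
  exact congrArg (transAd s s' y) (tangent_coordSymm_self (E' := EG) (1 : G) X).symm

lemma contMDiffAt_transMC [LieGroup 𝓘(ℝ, EG) ∞ G] (hx : x ∈ s.dom) (hx' : x ∈ s'.dom) {x₀ : M}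
    (hx₀ : x ∈ (trivializationAt EM (TangentSpace 𝓘(ℝ, EM)) x₀).baseSet) :
    ContMDiffAt 𝓘(ℝ, EM) 𝓘(ℝ, EM →L[ℝ] EG) ∞ (fun y => transMC s s' y ∘L tmInv x₀ y) x := by
  have hγ := contMDiffAt_trans hx hx'
  have hf : ContMDiffAt (𝓘(ℝ, EM).prod 𝓘(ℝ, EM)) 𝓘(ℝ, EG) ∞
      (Function.uncurry fun (y z : M) => (s.trans s' z)⁻¹ * s.trans s' y) (x, x) := by
    have h1 : ContMDiffAt (𝓘(ℝ, EM).prod 𝓘(ℝ, EM)) 𝓘(ℝ, EG) ∞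
      (fun q : M × M => s.trans s' q.1) (x, x) := ContMDiffAt.comp (g := s.trans s') (x, x) hγ contMDiffAt_fst
    have h2 : ContMDiffAt (𝓘(ℝ, EM).prod 𝓘(ℝ, EM)) 𝓘(ℝ, EG) ∞
      (fun q : M × M => s.trans s' q.2) (x, x) := ContMDiffAt.comp (g := s.trans s') (x, x) hγ contMDiffAt_snd
    exact h2.inv.mul h1
  have h : ContMDiffAt 𝓘(ℝ, EM) 𝓘(ℝ, EM →L[ℝ] EG) ∞ (inTangentCoordinates 𝓘(ℝ, EM) 𝓘(ℝ, EG)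
      (fun y : M => y) (fun y => (s.trans s' y)⁻¹ * s.trans s' y) (transMC s s') x) x :=
    ContMDiffAt.mfderiv (m := ∞) (fun (y z : M) => (s.trans s' z)⁻¹ * s.trans s' y)
      (fun y : M => y) hf contMDiffAt_id (by simp)
  have hself := mem_baseSet_trivializationAt EM (TangentSpace 𝓘(ℝ, EM)) x
  have h3 := h.clm_comp (contMDiffAt_tmCoord_tmInv hx₀ hself)
  refine h3.congr_of_eventuallyEq ?_
  filter_upwards [(trivializationAt EM (TangentSpace 𝓘(ℝ, EM)) x).open_baseSet.mem_nhds hself] with y hy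
  ext v
  have h4 := inTangentCoordinates_apply (fun y : M => y)
    (fun y => (s.trans s' y)⁻¹ * s.trans s' y) (transMC s s') x y (by simp)
    ((tmCoord x y : EM →L[ℝ] EM) (tmInv x₀ y v))
  rw [ContinuousLinearMap.comp_apply, ContinuousLinearMap.comp_apply,
    ContinuousLinearMap.comp_apply, h4]
  exact congrArg (transMC s s' y) (tmInv_tmCoord hy _).symm

/-- The linear coordinates `At(E)_x → EM × 𝔤` given by a local section and a chart of `M`. -/
noncomputable def atChart (s : E.LocalSection) (x₀ x : M) : E.At x →ₗ[ℝ] EM × EG :=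
  open Classical in
  if hx : x ∈ s.dom then
    (LinearMap.prodMap (tmCoord x₀ x : EM →L[ℝ] EM).toLinearMap LinearMap.id) ∘ₗ
      (atEquiv hx).toLinearMap
  else 0

/-- The inverse of the linear coordinates `atChart`. -/
noncomputable def atInv (s : E.LocalSection) (x₀ x : M) : EM × EG →ₗ[ℝ] E.At x :=
  open Classical in
  if hx : x ∈ s.dom then
    (atEquiv hx).symm.toLinearMap ∘ₗ
      (LinearMap.prodMap (tmInv x₀ x : EM →L[ℝ] EM).toLinearMap LinearMap.id)
  else 0

lemma atChart_apply (hx : x ∈ s.dom) (x₀ : M) (σ : E.At x) :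
    atChart s x₀ x σ = ((tmCoord x₀ x : EM →L[ℝ] EM) (E.anchor x σ),
      s.dfib x (E.ev (s.proj_sec x hx) σ)) := by
  rw [atChart, dif_pos hx]
  rfl

lemma atInv_apply (hx : x ∈ s.dom) (x₀ : M) (q : EM × EG) :
    atInv s x₀ x q = (atEquiv hx).symm ((tmInv x₀ x : EM →L[ℝ] EM) q.1, q.2) := by
  rw [atInv, dif_pos hx]
  rfl

lemma atInv_atChart (hx : x ∈ s.dom) {x₀ : M}
    (hx₀ : x ∈ (trivializationAt EM (TangentSpace 𝓘(ℝ, EM)) x₀).baseSet) (σ : E.At x) :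
    atInv s x₀ x (atChart s x₀ x σ) = σ := by
  rw [atInv_apply hx, atChart_apply hx]
  refine Eq.trans ?_ ((atEquiv hx).symm_apply_apply σ)
  exact congrArg (fun v : EM => (atEquiv hx).symm (v, s.dfib x (E.ev (s.proj_sec x hx) σ)))
    (tmInv_tmCoord hx₀ _)

lemma atChart_atInv' (hx : x ∈ s.dom) (hx' : x ∈ s'.dom) (x₀ x₁ : M) (q : EM × EG) :
    atChart s' x₁ x (atInv s x₀ x q) =
      ((tmCoord x₁ x : EM →L[ℝ] EM) (tmInv x₀ x q.1),
        transMC s s' x (tmInv x₀ x q.1) + transAd s s' x q.2) := by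
  rw [atInv_apply hx, atChart_apply hx']
  have h := atEquiv_atEquiv_symm hx hx' ((tmInv x₀ x : EM →L[ℝ] EM) q.1, q.2)
  exact congrArg (fun r : EM × EG => ((tmCoord x₁ x : EM →L[ℝ] EM) r.1, r.2)) h

lemma atChart_atInv (hx : x ∈ s.dom) {x₀ : M}
    (hx₀ : x ∈ (trivializationAt EM (TangentSpace 𝓘(ℝ, EM)) x₀).baseSet) (q : EM × EG) :
    atChart s x₀ x (atInv s x₀ x q) = q := by
  rw [atInv_apply hx, atChart_apply hx]
  have h := (atEquiv hx).apply_symm_apply ((tmInv x₀ x : EM →L[ℝ] EM) q.1, q.2)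
  refine (congrArg (fun r : EM × EG => ((tmCoord x₀ x : EM →L[ℝ] EM) r.1, r.2)) h).trans ?_
  exact Prod.ext (tmCoord_tmInv hx₀ _) rfl

lemma continuous_atChart (hx : x ∈ s.dom) (x₀ : M) : Continuous (atChart s x₀ x) := by
  have h : (atChart s x₀ x : E.At x → EM × EG) = fun σ =>
      ((tmCoord x₀ x : EM →L[ℝ] EM) (E.anchor x σ), s.dfib x (E.ev (s.proj_sec x hx) σ)) :=
    funext (atChart_apply hx x₀)
  rw [h]
  have h1 : Continuous fun σ : E.At x => (E.ev (s.proj_sec x hx) σ : EP) :=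
    (continuous_apply (⟨s.sec x, s.proj_sec x hx⟩ : {z : P // E.proj z = x})).comp
      continuous_subtype_val
  exact ((tmCoord x₀ x : EM →L[ℝ] EM).continuous.comp (E.anchor x).continuous).prodMk
    ((s.dfib x).continuous.comp h1)

lemma continuous_atInv (hx : x ∈ s.dom) (x₀ : M) : Continuous (atInv s x₀ x) := by
  have h : (atInv s x₀ x : EM × EG → E.At x) = fun q =>
      (atEquiv hx).symm ((tmInv x₀ x : EM →L[ℝ] EM) q.1, q.2) := funext (atInv_apply hx x₀)
  rw [h]
  refine continuous_induced_rng.2 (continuous_pi fun z => ?_)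
  have h1 : Continuous fun q : EM × EG =>
      (s.dsec x ((tmInv x₀ x : EM →L[ℝ] EM) q.1) + s.dorb x q.2 : EP) := by fun_prop
  exact (E.dR (E.div (s.sec x) z.1) (s.sec x)).continuous.comp h1

/-- The `𝔤`-component of `atChart`, as linear coordinates on `ad(E)_x`. -/
noncomputable def adChart (s : E.LocalSection) (x₀ x : M) : E.Ad x →ₗ[ℝ] EG :=
  LinearMap.snd ℝ EM EG ∘ₗ atChart s x₀ x ∘ₗ (E.adIncl x).toLinearMap

lemma atInv_mem (hx : x ∈ s.dom) (x₀ : M) (X : EG) :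
    atInv s x₀ x (0, X) ∈ E.adSubmodule x := by
  rw [mem_adSubmodule_iff, atInv_apply hx]
  have h := congrArg Prod.fst ((atEquiv hx).apply_symm_apply ((tmInv x₀ x : EM →L[ℝ] EM) 0, X))
  exact h.trans (map_zero _)

/-- The inverse of the linear coordinates `adChart`, over the domain of the section. -/
noncomputable def adInvOn (hx : x ∈ s.dom) (x₀ : M) : EG →ₗ[ℝ] E.Ad x where
  toFun X := ⟨atInv s x₀ x (0, X), atInv_mem hx x₀ X⟩
  map_add' X Y := by
    have h := (atInv s x₀ x).map_add (0, X) (0, Y)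
    rw [Prod.mk_add_mk, add_zero] at h
    exact Subtype.ext h
  map_smul' c X := by
    have h := (atInv s x₀ x).map_smul c (0, X)
    rw [Prod.smul_mk, smul_zero] at h
    exact Subtype.ext h

/-- The inverse of the linear coordinates `adChart`. -/
noncomputable def adInv (s : E.LocalSection) (x₀ x : M) : EG →ₗ[ℝ] E.Ad x :=
  open Classical in
  if hx : x ∈ s.dom then adInvOn hx x₀ else 0

lemma adIncl_adInv (hx : x ∈ s.dom) (x₀ : M) (X : EG) :
    E.adIncl x (adInv s x₀ x X) = atInv s x₀ x (0, X) := by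
  rw [adInv, dif_pos hx]
  rfl

lemma atChart_adIncl (hx : x ∈ s.dom) (x₀ : M) (σ : E.Ad x) :
    atChart s x₀ x (E.adIncl x σ) = (0, adChart s x₀ x σ) := by
  refine Prod.ext ?_ rfl
  rw [atChart_apply hx]
  have h : E.anchor x (E.adIncl x σ) = 0 := (E.mem_adSubmodule_iff _).1 σ.2
  exact (congrArg (tmCoord x₀ x : EM →L[ℝ] EM) h).trans (map_zero _)

lemma adInv_adChart (hx : x ∈ s.dom) {x₀ : M}
    (hx₀ : x ∈ (trivializationAt EM (TangentSpace 𝓘(ℝ, EM)) x₀).baseSet) (σ : E.Ad x) :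
    adInv s x₀ x (adChart s x₀ x σ) = σ := by
  refine Subtype.ext ?_
  refine (adIncl_adInv hx x₀ _).trans ?_
  rw [← atChart_adIncl hx, atInv_atChart hx hx₀]
  rfl

lemma adChart_adInv' (hx : x ∈ s.dom) (hx' : x ∈ s'.dom) (x₀ x₁ : M) (X : EG) :
    adChart s' x₁ x (adInv s x₀ x X) = transAd s s' x X := by
  have h : adChart s' x₁ x (adInv s x₀ x X) =
    (atChart s' x₁ x (E.adIncl x (adInv s x₀ x X))).2 := rfl
  rw [h, adIncl_adInv hx, atChart_atInv' hx hx']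
  simp

lemma adChart_adInv (hx : x ∈ s.dom) {x₀ : M}
    (hx₀ : x ∈ (trivializationAt EM (TangentSpace 𝓘(ℝ, EM)) x₀).baseSet) (X : EG) :
    adChart s x₀ x (adInv s x₀ x X) = X := by
  have h : adChart s x₀ x (adInv s x₀ x X) =
    (atChart s x₀ x (E.adIncl x (adInv s x₀ x X))).2 := rfl
  rw [h, adIncl_adInv hx, atChart_atInv hx hx₀]

lemma continuous_adChart (hx : x ∈ s.dom) (x₀ : M) : Continuous (adChart s x₀ x) :=
  continuous_snd.comp ((continuous_atChart hx x₀).comp (E.adIncl x).continuous)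

lemma continuous_adInv (hx : x ∈ s.dom) (x₀ : M) : Continuous (adInv s x₀ x) := by
  refine continuous_induced_rng.2 ?_
  change Continuous fun X => E.adIncl x (adInv s x₀ x X)
  simp_rw [adIncl_adInv hx]
  exact (continuous_atInv hx x₀).comp (by fun_prop)

end Smoothness

end LocalSection

section Bundles

variable [IsManifold 𝓘(ℝ, EM) ∞ M] [IsManifold 𝓘(ℝ, EP) ∞ P] [LieGroup 𝓘(ℝ, EG) ∞ G]

open LocalSection

/-- The linear charts of the Atiyah bundle: over the domain of a smooth local section `s` of `P`,
`At(E) ≅ TM ⊕ 𝔤`, where `(v, X)` corresponds to the invariant section with value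
`ds(v) + X · s(x)` at `s(x)` (here `X · z` is the velocity at `t = 0` of `z exp(tX)`), combined with
a coordinate trivialization of `TM`. -/
noncomputable def atCharts : LinearCharts EM (EM × EG) E.At (E.LocalSection × M) where
  dom i := i.1.dom ∩ (trivializationAt EM (TangentSpace 𝓘(ℝ, EM)) i.2).baseSet
  isOpen_dom i := i.1.isOpen_dom.inter (trivializationAt EM _ i.2).open_baseSet
  chart i x := atChart i.1 i.2 x
  inv i x := atInv i.1 i.2 x
  inv_chart _ _ hx σ := atInv_atChart hx.1 hx.2 σ
  chart_inv _ _ hx q := atChart_atInv hx.1 hx.2 q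
  pref x := ((E.exists_localSection x).choose, x)
  mem_pref x := ⟨(E.exists_localSection x).choose_spec, mem_baseSet_trivializationAt EM _ x⟩
  transition i j := by
    refine ⟨fun x => ContinuousLinearMap.inl ℝ EM EG ∘L
        (((tmCoord j.2 x : EM →L[ℝ] EM) ∘L (tmInv i.2 x : EM →L[ℝ] EM)) ∘L
          ContinuousLinearMap.fst ℝ EM EG) +
      ContinuousLinearMap.inr ℝ EM EG ∘L
        ((transMC i.1 j.1 x ∘L (tmInv i.2 x : EM →L[ℝ] EM)) ∘L ContinuousLinearMap.fst ℝ EM EG +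
          transAd i.1 j.1 x ∘L ContinuousLinearMap.snd ℝ EM EG), ?_, ?_⟩
    · intro x hx
      refine ContMDiffAt.contMDiffWithinAt ?_
      have h1 := contMDiffAt_tmCoord_tmInv hx.1.2 hx.2.2
      have h2 := contMDiffAt_transMC hx.1.1 hx.2.1 hx.1.2
      have h3 := contMDiffAt_transAd hx.1.1 hx.2.1
      exact (contMDiffAt_const.clm_comp (h1.clm_comp contMDiffAt_const)).add
        (contMDiffAt_const.clm_comp
          ((h2.clm_comp contMDiffAt_const).add (h3.clm_comp contMDiffAt_const)))
    · intro x hx q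
      rw [atChart_atInv' hx.1.1 hx.2.1 i.2 j.2 q]
      simp
  isInducing x := by
    have hx := (E.exists_localSection x).choose_spec
    have hx₀ := mem_baseSet_trivializationAt EM (TangentSpace 𝓘(ℝ, EM)) x
    have h : Function.LeftInverse (atInv (E.exists_localSection x).choose x x)
        (atChart (E.exists_localSection x).choose x x) := fun σ => atInv_atChart hx hx₀ σ
    exact (h.isEmbedding (continuous_atInv hx x) (continuous_atChart hx x)).isInducing

/-- The linear charts of the adjoint bundle: over the domain of a smooth local section `s` of `P`,
`ad(E) ≅ 𝔤`, where `X` corresponds to the invariant section with value `X · s(x)` at `s(x)`. -/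
noncomputable def adCharts : LinearCharts EM EG E.Ad (E.LocalSection × M) where
  dom i := i.1.dom ∩ (trivializationAt EM (TangentSpace 𝓘(ℝ, EM)) i.2).baseSet
  isOpen_dom i := i.1.isOpen_dom.inter (trivializationAt EM _ i.2).open_baseSet
  chart i x := adChart i.1 i.2 x
  inv i x := adInv i.1 i.2 x
  inv_chart _ _ hx σ := adInv_adChart hx.1 hx.2 σ
  chart_inv _ _ hx q := adChart_adInv hx.1 hx.2 q
  pref x := ((E.exists_localSection x).choose, x)
  mem_pref x := ⟨(E.exists_localSection x).choose_spec, mem_baseSet_trivializationAt EM _ x⟩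
  transition i j := by
    refine ⟨transAd i.1 j.1, ?_, ?_⟩
    · intro x hx
      exact (contMDiffAt_transAd hx.1.1 hx.2.1).contMDiffWithinAt
    · intro x hx q
      exact (adChart_adInv' hx.1.1 hx.2.1 i.2 j.2 q).symm
  isInducing x := by
    have hx := (E.exists_localSection x).choose_spec
    have hx₀ := mem_baseSet_trivializationAt EM (TangentSpace 𝓘(ℝ, EM)) x
    have h : Function.LeftInverse (adInv (E.exists_localSection x).choose x x)
        (adChart (E.exists_localSection x).choose x x) := fun σ => adInv_adChart hx hx₀ σ
    exact (h.isEmbedding (continuous_adInv hx x) (continuous_adChart hx x)).isInducing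

/- The smooth vector bundles `At(E)` and `ad(E)` over `M`. -/
noncomputable instance : TopologicalSpace (TotalSpace (EM × EG) E.At) :=
  E.atCharts.prebundle.totalSpaceTopology
noncomputable instance : FiberBundle (EM × EG) E.At := E.atCharts.prebundle.toFiberBundle
instance : VectorBundle ℝ (EM × EG) E.At := E.atCharts.prebundle.toVectorBundle
instance : ContMDiffVectorBundle ∞ (EM × EG) E.At 𝓘(ℝ, EM) :=
  E.atCharts.prebundle.contMDiffVectorBundle 𝓘(ℝ, EM)

noncomputable instance : TopologicalSpace (TotalSpace EG E.Ad) :=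
  E.adCharts.prebundle.totalSpaceTopology
noncomputable instance : FiberBundle EG E.Ad := E.adCharts.prebundle.toFiberBundle
instance : VectorBundle ℝ EG E.Ad := E.adCharts.prebundle.toVectorBundle
instance : ContMDiffVectorBundle ∞ EG E.Ad 𝓘(ℝ, EM) :=
  E.adCharts.prebundle.contMDiffVectorBundle 𝓘(ℝ, EM)

/-- The vector bundle `At(E) ⊗ T*M = Hom(TM, At(E))`. -/
abbrev HomAt (x : M) : Type _ := TangentSpace 𝓘(ℝ, EM) x →L[ℝ] E.At x

/-- The vector bundle `Hom(TM, ad(E))`. -/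
abbrev HomAd (x : M) : Type _ := TangentSpace 𝓘(ℝ, EM) x →L[ℝ] E.Ad x

/-- The fibre of `𝒞(E) = (η ⊗ Id)⁻¹(Id_{TM})` over `x`. -/
def ConnFiber (x : M) : Type _ :=
  {φ : E.HomAt x // E.anchor x ∘L φ = ContinuousLinearMap.id ℝ (TangentSpace 𝓘(ℝ, EM) x)}

lemma nonempty_connFiber (x : M) : Nonempty (E.ConnFiber x) := by
  obtain ⟨s, hx⟩ := E.exists_localSection x
  let φ : E.HomAt x := (⟨atInv s x x, continuous_atInv hx x⟩ : EM × EG →L[ℝ] E.At x) ∘L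
    ContinuousLinearMap.inl ℝ EM EG ∘L (tmCoord x x : EM →L[ℝ] EM)
  refine ⟨⟨φ, ?_⟩⟩
  ext v
  have h1 : φ v = (atEquiv hx).symm ((tmInv x x : EM →L[ℝ] EM) (tmCoord x x v), 0) :=
    atInv_apply hx x _
  have h2 : E.anchor x ((atEquiv hx).symm ((tmInv x x : EM →L[ℝ] EM) (tmCoord x x v), 0)) =
      (tmInv x x : EM →L[ℝ] EM) (tmCoord x x v) :=
    congrArg Prod.fst ((atEquiv hx).apply_symm_apply
      ((tmInv x x : EM →L[ℝ] EM) (tmCoord x x v), (0 : EG)))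
  have h3 : (tmInv x x : EM →L[ℝ] EM) (tmCoord x x v) = v :=
    tmInv_tmCoord (mem_baseSet_trivializationAt EM _ x) v
  exact (congrArg (E.anchor x) h1).trans (h2.trans h3)

/-- Two elements of `𝒞(E)_x` differ by a homomorphism `T_x M → ad(E)_x`. -/
noncomputable def connSub {x : M} (φ ψ : E.ConnFiber x) : E.HomAd x where
  toFun v := ⟨φ.1 v - ψ.1 v, by
    have h1 := DFunLike.congr_fun φ.2 v
    have h2 := DFunLike.congr_fun ψ.2 v
    rw [mem_adSubmodule_iff, map_sub]
    exact sub_eq_zero.2 (h1.trans h2.symm)⟩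
  map_add' v w := Subtype.ext (by
    change φ.1 (v + w) - ψ.1 (v + w) = (φ.1 v - ψ.1 v) + (φ.1 w - ψ.1 w)
    rw [map_add, map_add]; abel)
  map_smul' c v := Subtype.ext (by
    change φ.1 (c • v) - ψ.1 (c • v) = c • (φ.1 v - ψ.1 v)
    rw [map_smul, map_smul, smul_sub])
  cont := continuous_induced_rng.2 (φ.1.continuous.sub ψ.1.continuous)

/-- `𝒞(E)_x` is an affine space for `Hom(T_x M, ad(E)_x)`, acting by `φ ↦ ι₀ ∘ A + φ`. -/
noncomputable instance (x : M) : AddTorsor (E.HomAd x) (E.ConnFiber x) where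
  vadd A φ := ⟨E.adIncl x ∘L A + φ.1, by
    ext v
    have h := DFunLike.congr_fun φ.2 v
    refine (map_add (E.anchor x) _ _).trans ?_
    exact (congrArg₂ (· + ·) (E.anchor_adIncl x (A v)) h).trans (zero_add _)⟩
  vsub φ ψ := E.connSub φ ψ
  zero_vadd φ := Subtype.ext (by
    change E.adIncl x ∘L (0 : E.HomAd x) + φ.1 = φ.1
    rw [ContinuousLinearMap.comp_zero, zero_add])
  add_vadd A B φ := Subtype.ext (by
    change E.adIncl x ∘L (A + B) + φ.1 = E.adIncl x ∘L A + (E.adIncl x ∘L B + φ.1)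
    rw [ContinuousLinearMap.comp_add, add_assoc])
  nonempty := E.nonempty_connFiber x
  vsub_vadd' φ ψ := Subtype.ext (by
    ext v : 1
    exact sub_add_cancel (φ.1 v) (ψ.1 v))
  vadd_vsub' A φ := by
    ext v : 1
    exact Subtype.ext (add_sub_cancel_right (E.adIncl x (A v)) (φ.1 v))

/-- The total space of `δ : 𝒞(E) → M`. -/
abbrev ConnBundle : Type _ := TotalSpace (EM →L[ℝ] EG) E.ConnFiber

/-- The inclusion `𝒞(E) ⊆ At(E) ⊗ T*M = Hom(TM, At(E))`. -/
def connIncl (c : E.ConnBundle) : TotalSpace (EM →L[ℝ] EM × EG) E.HomAt := ⟨c.proj, c.snd.1⟩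

/-- `𝒞(E)` carries the subspace topology. -/
noncomputable instance : TopologicalSpace E.ConnBundle :=
  TopologicalSpace.induced E.connIncl inferInstance

/-- A connection on the principal bundle: a smooth splitting `D : TM → At(E)` of the Atiyah
sequence, that is, a smooth homomorphism of vector bundles with `η ∘ D = Id`. -/
structure Connection where
  hom : ∀ x : M, TangentSpace 𝓘(ℝ, EM) x →L[ℝ] E.At x
  contMDiff_hom : ContMDiff 𝓘(ℝ, EM).tangent (𝓘(ℝ, EM).prod 𝓘(ℝ, EM × EG)) ∞
    (fun v : TangentBundle 𝓘(ℝ, EM) M =>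
      (⟨v.proj, hom v.proj v.snd⟩ : TotalSpace (EM × EG) E.At))
  anchor_comp_hom : ∀ x : M,
    E.anchor x ∘L hom x = ContinuousLinearMap.id ℝ (TangentSpace 𝓘(ℝ, EM) x)

/-- The point of `𝒞(E)_x` given by a connection. -/
def Connection.toFiber {E : SmoothPrincipalBundle EM EG EP M G P} (D : E.Connection) (x : M) :
    E.ConnFiber x := ⟨D.hom x, D.anchor_comp_hom x⟩

end Bundles

end SmoothPrincipalBundle
end PrincipalBundle

/-- `A` is a smooth affine bundle over the manifold `B`, modelled on the smooth vector bundle `V`: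
every fibre `A x` is an affine space for `V x`, and near every point there is a smooth local
trivialization of the total space of `A` that is affine on the fibres and has as its linear part
a local trivialization of `V`. -/
structure IsSmoothAffineBundle (EB : Type*) [NormedAddCommGroup EB] [NormedSpace ℝ EB]
    {B : Type*} [TopologicalSpace B] [ChartedSpace EB B]
    (F : Type*) [NormedAddCommGroup F] [NormedSpace ℝ F]
    (V : B → Type*) [∀ x, AddCommGroup (V x)] [∀ x, Module ℝ (V x)]
    [∀ x, TopologicalSpace (V x)] [TopologicalSpace (TotalSpace F V)]
    [FiberBundle F V] [VectorBundle ℝ F V]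
    (A : B → Type*) [∀ x, AddTorsor (V x) (A x)]
    [TopologicalSpace (TotalSpace F A)] [ChartedSpace (ModelProd EB F) (TotalSpace F A)] :
    Prop where
  contMDiffVectorBundle : ContMDiffVectorBundle ∞ F V 𝓘(ℝ, EB)
  isManifold : IsManifold (𝓘(ℝ, EB).prod 𝓘(ℝ, F)) ∞ (TotalSpace F A)
  exists_trivialization : ∀ x : B, ∃ (e : Trivialization F (π F V)) (Φ : Trivialization F (π F A)),
    MemTrivializationAtlas e ∧ x ∈ Φ.baseSet ∧ Φ.baseSet ⊆ e.baseSet ∧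
    ContMDiffOn (𝓘(ℝ, EB).prod 𝓘(ℝ, F)) (𝓘(ℝ, EB).prod 𝓘(ℝ, F)) ∞ Φ Φ.source ∧
    ContMDiffOn (𝓘(ℝ, EB).prod 𝓘(ℝ, F)) (𝓘(ℝ, EB).prod 𝓘(ℝ, F)) ∞
      Φ.toOpenPartialHomeomorph.symm Φ.target ∧
    ∀ y ∈ Φ.baseSet, ∀ (v : V y) (a : A y), (Φ ⟨y, v +ᵥ a⟩).2 = (e ⟨y, v⟩).2 + (Φ ⟨y, a⟩).2

/-!
The bundle `𝒞(E)` is `Hom(TM, ad(E))` translated by a connection, once a connection is known to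
exist.

A local section of `P` and a chart of `M` trivialize `TM`, `ad(E)` and `At(E)` over an open set in
such a way that `η` becomes the first projection of `EM × EG` and `ι₀` the inclusion of the second
factor (`fst_at_continuousLinearMapAt`, `at_continuousLinearMapAt_adIncl`). Over such a set
`v ↦ (v, 0)` is a connection. The condition `η ∘ φ = Id` cuts out a convex subset of each fibre of
`Hom(TM, At(E))`, so a partition of unity yields a global connection
(`exists_section_anchor_comp`, `nonempty_connection`).

A connection `D` gives the bijection `(x, A) ↦ ι₀ ∘ A + D(x)` from `Hom(TM, ad(E))` onto `𝒞(E)`.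
Followed by the inclusion of `𝒞(E)`, it is the map `A ↦ ι₀ ∘ A` followed by the translation by `D`,
a diffeomorphism of `Hom(TM, At(E))`. As `A ↦ ι₀ ∘ A` reflects continuity
(`continuousAt_homIncl_comp_iff`), the bijection is a homeomorphism for the subspace topology of
`𝒞(E)`, and the smooth structure of `Hom(TM, ad(E))` can be transported along it. In the
trivializations above `A ↦ ι₀ ∘ A` is a linear inclusion, so that `𝒞(E)` is embedded
(`Connection.isSmoothEmbedding_connIncl`), and the linear trivializations of `Hom(TM, ad(E))` become
affine trivializations of `𝒞(E)` (`Connection.isSmoothAffineBundle`). Any other connection `D'`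
differs from `D` by a smooth section of `Hom(TM, ad(E))`, hence the bijection that it defines differs
from that of `D` by a translation, and is a diffeomorphism as well (`Connection.exists_diffeomorph`).
-/

/-! ### Transport of a manifold structure along a homeomorphism -/

section TransportedManifold

variable {𝕜 : Type*} [NontriviallyNormedField 𝕜] {E₁ : Type*} [NormedAddCommGroup E₁]
  [NormedSpace 𝕜 E₁] {H : Type*} [TopologicalSpace H] {I : ModelWithCorners 𝕜 E₁ H} {n : ℕ∞ω}
  {X Y : Type*} [TopologicalSpace X] [ChartedSpace H X] [TopologicalSpace Y]

/-- The charted space structure on `Y` whose charts are the compositions of the homeomorphism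
`h : Y ≃ₜ X` with the charts of `X`. -/
@[reducible]
def Homeomorph.pullbackChartedSpace (H : Type*) [TopologicalSpace H] [ChartedSpace H X]
    (h : Y ≃ₜ X) : ChartedSpace H Y where
  atlas := h.transOpenPartialHomeomorph '' atlas H X
  chartAt y := h.transOpenPartialHomeomorph (chartAt H (h y))
  mem_chart_source y := mem_chart_source H (h y)
  chart_mem_atlas y := mem_image_of_mem _ (chart_mem_atlas H (h y))

lemma Homeomorph.isManifold_pullback [IsManifold I n X] (h : Y ≃ₜ X) :
    letI := h.pullbackChartedSpace H
    IsManifold I n Y := by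
  let := h.pullbackChartedSpace H
  have : HasGroupoid Y (contDiffGroupoid n I) := by
    refine ⟨?_⟩
    rintro _ _ ⟨e, he, rfl⟩ ⟨e', he', rfl⟩
    refine (contDiffGroupoid n I).mem_of_eqOnSource
      (HasGroupoid.compatible (G := contDiffGroupoid n I) he he') ⟨?_, ?_⟩
    · ext z; simp
    · intro z hz; simp
  exact IsManifold.mk' I n Y

lemma Homeomorph.contMDiff_pullback [IsManifold I n X] (h : Y ≃ₜ X) :
    letI := h.pullbackChartedSpace H
    ContMDiff I I n h := by
  let := h.pullbackChartedSpace H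
  have : IsManifold I n Y := h.isManifold_pullback
  intro y
  refine contMDiffAt_iff.2 ⟨h.continuous.continuousAt, ?_⟩
  refine contDiffWithinAt_id.congr_of_eventuallyEq_of_mem ?_ (mem_range_self _)
  have : (extChartAt I y).target ∈ 𝓝[range I] (extChartAt I y y) := extChartAt_target_mem_nhdsWithin y
  filter_upwards [this] with z hz
  exact (extChartAt I y).right_inv hz

lemma Homeomorph.contMDiff_pullback_symm [IsManifold I n X] (h : Y ≃ₜ X) :
    letI := h.pullbackChartedSpace H
    ContMDiff I I n h.symm := by
  let := h.pullbackChartedSpace H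
  have : IsManifold I n Y := h.isManifold_pullback
  intro x
  refine contMDiffAt_iff.2 ⟨h.symm.continuous.continuousAt, ?_⟩
  refine contDiffWithinAt_id.congr_of_eventuallyEq_of_mem ?_ (mem_range_self _)
  have : (extChartAt I x).target ∈ 𝓝[range I] (extChartAt I x x) := extChartAt_target_mem_nhdsWithin x
  filter_upwards [this] with z hz
  have h1 := (extChartAt I x).right_inv hz
  have hc : chartAt H (h.symm x) = h.transOpenPartialHomeomorph (chartAt H x) :=
    congrArg (fun w => h.transOpenPartialHomeomorph (chartAt H w)) (h.apply_symm_apply x)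
  simpa [extChartAt, hc, Function.comp_def] using h1

end TransportedManifold

/-! ### Translations of a vector bundle by smooth sections -/

section Translation

variable {EB : Type*} [NormedAddCommGroup EB] [NormedSpace ℝ EB]
  {B : Type*} [TopologicalSpace B] [ChartedSpace EB B]
  {F : Type*} [NormedAddCommGroup F] [NormedSpace ℝ F]
  {V : B → Type*} [∀ x, AddCommGroup (V x)] [∀ x, Module ℝ (V x)] [∀ x, TopologicalSpace (V x)]
  [TopologicalSpace (TotalSpace F V)] [FiberBundle F V] [VectorBundle ℝ F V]

lemma contMDiff_add_section {s : ∀ x, V x}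
    (hs : ContMDiff 𝓘(ℝ, EB) (𝓘(ℝ, EB).prod 𝓘(ℝ, F)) ∞ (fun x => TotalSpace.mk' F x (s x))) :
    ContMDiff (𝓘(ℝ, EB).prod 𝓘(ℝ, F)) (𝓘(ℝ, EB).prod 𝓘(ℝ, F)) ∞
      (fun p : TotalSpace F V => TotalSpace.mk' F p.proj (p.snd + s p.proj)) := by
  intro p
  have hp : ContMDiffAt (𝓘(ℝ, EB).prod 𝓘(ℝ, F)) (𝓘(ℝ, EB).prod 𝓘(ℝ, F)) ∞
    (fun q : TotalSpace F V => q) p := contMDiffAt_id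
  rw [Bundle.contMDiffAt_totalSpace] at hp ⊢
  refine ⟨hp.1, ?_⟩
  have h1 := ((Bundle.contMDiffAt_section _).1 (hs p.proj)).comp p hp.1
  refine (hp.2.add h1).congr_of_eventuallyEq ?_
  have hU := hp.1.continuousAt.preimage_mem_nhds
    ((trivializationAt F V p.proj).open_baseSet.mem_nhds (mem_baseSet_trivializationAt F V p.proj))
  filter_upwards [hU] with q hq
  exact ((trivializationAt F V p.proj).linear ℝ hq).map_add _ _

/-- Translation of the total space of a vector bundle by a smooth section. -/
def translationDiffeomorph (s : ∀ x, V x)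
    (hs : ContMDiff 𝓘(ℝ, EB) (𝓘(ℝ, EB).prod 𝓘(ℝ, F)) ∞ (fun x => TotalSpace.mk' F x (s x))) :
    Diffeomorph (𝓘(ℝ, EB).prod 𝓘(ℝ, F)) (𝓘(ℝ, EB).prod 𝓘(ℝ, F))
      (TotalSpace F V) (TotalSpace F V) ∞ where
  toFun p := ⟨p.proj, p.snd + s p.proj⟩
  invFun p := ⟨p.proj, p.snd + -s p.proj⟩
  left_inv p := by simp
  right_inv p := by simp
  contMDiff_toFun := contMDiff_add_section hs
  contMDiff_invFun := contMDiff_add_section (s := fun x => -s x) hs.neg_section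

end Translation

/-! ### Smooth families of linear maps on a finite-dimensional space -/

section FiniteDimensional

/-- A family of linear maps on a finite-dimensional space depends smoothly on a parameter, for the
operator norm, if its value at every fixed vector does. -/
lemma contMDiffAt_clm_of_forall_apply {E₁ : Type*} [NormedAddCommGroup E₁] [NormedSpace ℝ E₁]
    {H : Type*} [TopologicalSpace H] {I : ModelWithCorners ℝ E₁ H}
    {X : Type*} [TopologicalSpace X] [ChartedSpace H X]
    {V : Type*} [NormedAddCommGroup V] [NormedSpace ℝ V] [FiniteDimensional ℝ V]
    {W : Type*} [NormedAddCommGroup W] [NormedSpace ℝ W] {n : ℕ∞ω}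
    {f : X → V →L[ℝ] W} {x : X} (h : ∀ v, ContMDiffAt I 𝓘(ℝ, W) n (fun y => f y v) x) :
    ContMDiffAt I 𝓘(ℝ, V →L[ℝ] W) n f x := by
  let b := Module.finBasis ℝ V
  -- `f y = ∑ i, bᵢ^* ⊗ f y bᵢ`
  let c i : W →L[ℝ] V →L[ℝ] W :=
    ContinuousLinearMap.smulRightL ℝ V W (LinearMap.toContinuousLinearMap (b.coord i))
  have hf : f = fun y => ∑ i, c i (f y (b i)) := by
    funext y
    ext v
    conv_lhs => rw [← b.sum_repr v, map_sum]
    simp [c]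
  rw [hf]
  exact contMDiffAt_finsetSum fun i _ => (c i).contMDiff.contMDiffAt.comp x (h (b i))

end FiniteDimensional

/-! ### The map `A ↦ ι₀ ∘ A` in local coordinates -/

namespace SmoothPrincipalBundle

open LocalSection

variable {EM : Type*} [NormedAddCommGroup EM] [NormedSpace ℝ EM]
  {EG : Type*} [NormedAddCommGroup EG] [NormedSpace ℝ EG]
  {EP : Type*} [NormedAddCommGroup EP] [NormedSpace ℝ EP]
  {M : Type*} [TopologicalSpace M] [ChartedSpace EM M] [IsManifold 𝓘(ℝ, EM) ∞ M]
  {G : Type*} [TopologicalSpace G] [ChartedSpace EG G] [Group G] [LieGroup 𝓘(ℝ, EG) ∞ G]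
  {P : Type*} [TopologicalSpace P] [ChartedSpace EP P] [IsManifold 𝓘(ℝ, EP) ∞ P]
  (E : SmoothPrincipalBundle EM EG EP M G P)

/-- The preferred local section of the principal bundle around `x₀`. -/
noncomputable abbrev prefSection (x₀ : M) : E.LocalSection := (E.exists_localSection x₀).choose

lemma at_continuousLinearMapAt {x₀ x : M} (hx : x ∈ (trivializationAt (EM × EG) E.At x₀).baseSet)
    (σ : E.At x) : (trivializationAt (EM × EG) E.At x₀).continuousLinearMapAt ℝ x σ =
      atChart (E.prefSection x₀) x₀ x σ :=
  (trivializationAt (EM × EG) E.At x₀).continuousLinearMapAt_apply_of_mem ℝ hx σ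

lemma ad_continuousLinearMapAt {x₀ x : M} (hx : x ∈ (trivializationAt EG E.Ad x₀).baseSet)
    (σ : E.Ad x) : (trivializationAt EG E.Ad x₀).continuousLinearMapAt ℝ x σ =
      adChart (E.prefSection x₀) x₀ x σ :=
  (trivializationAt EG E.Ad x₀).continuousLinearMapAt_apply_of_mem ℝ hx σ

/-- In the local coordinates of `At(E)` and `TM`, the map `η` is the first projection. -/
lemma fst_at_continuousLinearMapAt {x₀ x : M}
    (hx : x ∈ (trivializationAt (EM × EG) E.At x₀).baseSet) (σ : E.At x) :
    ((trivializationAt (EM × EG) E.At x₀).continuousLinearMapAt ℝ x σ).1 =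
      (trivializationAt EM (TangentSpace 𝓘(ℝ, EM)) x₀).continuousLinearMapAt ℝ x (E.anchor x σ) := by
  rw [at_continuousLinearMapAt E hx, atChart_apply (s := E.prefSection x₀) hx.1]
  rfl

/-- In the local coordinates of `ad(E)` and `At(E)`, the map `ι₀` is the inclusion of the second
factor. -/
lemma at_continuousLinearMapAt_adIncl {x₀ x : M}
    (hx : x ∈ (trivializationAt (EM × EG) E.At x₀).baseSet) (σ : E.Ad x) :
    (trivializationAt (EM × EG) E.At x₀).continuousLinearMapAt ℝ x (E.adIncl x σ) =
      (0, (trivializationAt EG E.Ad x₀).continuousLinearMapAt ℝ x σ) := by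
  rw [at_continuousLinearMapAt E hx, atChart_adIncl (s := E.prefSection x₀) hx.1,
    ad_continuousLinearMapAt E hx]

/-- The inclusion `Hom(TM, ad(E)) → Hom(TM, At(E))`, `A ↦ ι₀ ∘ A`. -/
noncomputable def homIncl (p : TotalSpace (EM →L[ℝ] EG) E.HomAd) :
    TotalSpace (EM →L[ℝ] EM × EG) E.HomAt := ⟨p.proj, E.adIncl p.proj ∘L p.snd⟩

lemma inCoordinates_adIncl_comp {x₀ x : M}
    (hx : x ∈ (trivializationAt (EM × EG) E.At x₀).baseSet) (A : E.HomAd x) :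
    ContinuousLinearMap.inCoordinates EM (TangentSpace 𝓘(ℝ, EM)) (EM × EG) E.At x₀ x x₀ x
        (E.adIncl x ∘L A) =
      ContinuousLinearMap.inr ℝ EM EG ∘L
        ContinuousLinearMap.inCoordinates EM (TangentSpace 𝓘(ℝ, EM)) EG E.Ad x₀ x x₀ x A := by
  ext1 v
  exact at_continuousLinearMapAt_adIncl E hx _

section

variable {EX : Type*} [NormedAddCommGroup EX] [NormedSpace ℝ EX] {HX : Type*} [TopologicalSpace HX]
  {IX : ModelWithCorners ℝ EX HX} {X : Type*} [TopologicalSpace X]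
  {f : X → TotalSpace (EM →L[ℝ] EG) E.HomAd} {x : X}

lemma eventually_mem_at_baseSet {b : X → M} (hb : ContinuousAt b x) :
    ∀ᶠ y in 𝓝 x, b y ∈ (trivializationAt (EM × EG) E.At (b x)).baseSet :=
  hb.preimage_mem_nhds ((trivializationAt (EM × EG) E.At (b x)).open_baseSet.mem_nhds
    (mem_baseSet_trivializationAt (EM × EG) E.At (b x)))

/-- The map `A ↦ ι₀ ∘ A` reflects continuity, since `ι₀` has a left inverse, the second projection,
in local coordinates. -/
lemma continuousAt_homIncl_comp_iff :
    ContinuousAt (fun y => E.homIncl (f y)) x ↔ ContinuousAt f x := by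
  rw [continuousAt_hom_bundle, continuousAt_hom_bundle]
  refine and_congr_right fun h1 => ⟨fun h2 => ?_, fun h2 => ?_⟩
  · have h3 : ContinuousAt (fun y => ContinuousLinearMap.snd ℝ EM EG ∘L
        ContinuousLinearMap.inCoordinates EM (TangentSpace 𝓘(ℝ, EM)) (EM × EG) E.At
          (f x).1 (f y).1 (f x).1 (f y).1 (E.homIncl (f y)).2) x :=
      continuousAt_const.clm_comp h2
    refine h3.congr ?_
    filter_upwards [E.eventually_mem_at_baseSet h1] with y hy
    exact congrArg (ContinuousLinearMap.snd ℝ EM EG ∘L ·) (E.inCoordinates_adIncl_comp hy (f y).2)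
  · refine ContinuousAt.congr (f := fun y => ContinuousLinearMap.inr ℝ EM EG ∘L
      ContinuousLinearMap.inCoordinates EM (TangentSpace 𝓘(ℝ, EM)) EG E.Ad
          (f x).1 (f y).1 (f x).1 (f y).1 (f y).2) (continuousAt_const.clm_comp h2) ?_
    filter_upwards [E.eventually_mem_at_baseSet h1] with y hy
    exact (E.inCoordinates_adIncl_comp hy (f y).2).symm

/-- The map `A ↦ ι₀ ∘ A` reflects smoothness, since `ι₀` has a left inverse, the second projection,
in local coordinates. -/
lemma contMDiffAt_homIncl_comp_iff [ChartedSpace HX X] :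
    ContMDiffAt IX (𝓘(ℝ, EM).prod 𝓘(ℝ, EM →L[ℝ] EM × EG)) ∞ (fun y => E.homIncl (f y)) x ↔
      ContMDiffAt IX (𝓘(ℝ, EM).prod 𝓘(ℝ, EM →L[ℝ] EG)) ∞ f x := by
  rw [contMDiffAt_hom_bundle, contMDiffAt_hom_bundle]
  refine and_congr_right fun h1 => ⟨fun h2 => ?_, fun h2 => ?_⟩
  · have h3 : ContMDiffAt IX 𝓘(ℝ, EM →L[ℝ] EG) ∞ (fun y => ContinuousLinearMap.snd ℝ EM EG ∘L
        ContinuousLinearMap.inCoordinates EM (TangentSpace 𝓘(ℝ, EM)) (EM × EG) E.At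
          (f x).1 (f y).1 (f x).1 (f y).1 (E.homIncl (f y)).2) x :=
      contMDiffAt_const.clm_comp h2
    refine h3.congr_of_eventuallyEq ?_
    filter_upwards [E.eventually_mem_at_baseSet h1.continuousAt] with y hy
    exact (congrArg (ContinuousLinearMap.snd ℝ EM EG ∘L ·)
      (E.inCoordinates_adIncl_comp hy (f y).2)).symm
  · refine ContMDiffAt.congr_of_eventuallyEq (f := fun y => ContinuousLinearMap.inr ℝ EM EG ∘L
      ContinuousLinearMap.inCoordinates EM (TangentSpace 𝓘(ℝ, EM)) EG E.Ad
          (f x).1 (f y).1 (f x).1 (f y).1 (f y).2) (contMDiffAt_const.clm_comp h2) ?_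
    filter_upwards [E.eventually_mem_at_baseSet h1.continuousAt] with y hy
    exact E.inCoordinates_adIncl_comp hy (f y).2

end

lemma contMDiff_homIncl : ContMDiff (𝓘(ℝ, EM).prod 𝓘(ℝ, EM →L[ℝ] EG))
    (𝓘(ℝ, EM).prod 𝓘(ℝ, EM →L[ℝ] EM × EG)) ∞ E.homIncl :=
  fun _ => E.contMDiffAt_homIncl_comp_iff.2 contMDiffAt_id

/-! ### Existence of connections -/

/-- An element of `Hom(TM, At(E))` with local coordinates `v ↦ (v, 0)` splits `η`. -/
lemma anchor_comp_eq_id {x₀ x : M}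
    (hx : x ∈ (trivializationAt (EM × EG) E.At x₀).baseSet) {φ : E.HomAt x}
    (hφ : ContinuousLinearMap.inCoordinates EM (TangentSpace 𝓘(ℝ, EM)) (EM × EG) E.At x₀ x x₀ x φ =
      ContinuousLinearMap.inl ℝ EM EG) :
    E.anchor x ∘L φ = ContinuousLinearMap.id ℝ (TangentSpace 𝓘(ℝ, EM) x) := by
  set e := trivializationAt EM (TangentSpace 𝓘(ℝ, EM)) x₀
  have hxe : x ∈ e.baseSet := hx.2
  ext1 v
  -- in coordinates `η ∘ φ` is the identity, and the coordinates of `TM` are invertible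
  have h1 := congrArg Prod.fst (DFunLike.congr_fun hφ (e.continuousLinearMapAt ℝ x v))
  have h2 := (E.fst_at_continuousLinearMapAt hx
    (φ (e.symmL ℝ x (e.continuousLinearMapAt ℝ x v)))).symm.trans h1
  rw [e.symmL_continuousLinearMapAt hxe] at h2
  have h3 := congrArg (e.symmL ℝ x) h2
  rw [e.symmL_continuousLinearMapAt hxe] at h3
  exact h3.trans (e.symmL_continuousLinearMapAt hxe v)

/-- The coordinates `v ↦ (v, 0)` define a connection near every point; the connections form
convex subsets of the fibres of `Hom(TM, At(E))`, so that local ones can be averaged. -/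
lemma exists_section_anchor_comp [FiniteDimensional ℝ EM] [T2Space M] [SecondCountableTopology M] :
    ∃ D : ∀ x, E.HomAt x,
      ContMDiff 𝓘(ℝ, EM) (𝓘(ℝ, EM).prod 𝓘(ℝ, EM →L[ℝ] EM × EG)) ∞
        (fun x => TotalSpace.mk' (EM →L[ℝ] EM × EG) x (D x)) ∧
      ∀ x, E.anchor x ∘L D x = ContinuousLinearMap.id ℝ (TangentSpace 𝓘(ℝ, EM) x) := by
  have : LocallyCompactSpace M := Manifold.locallyCompact_of_finiteDimensional 𝓘(ℝ, EM)
  obtain ⟨D, hD⟩ := exists_contMDiffSection_forall_mem_convex_of_local (n := ⊤) 𝓘(ℝ, EM)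
    (F_fiber := EM →L[ℝ] EM × EG) E.HomAt
    (fun x => {φ | E.anchor x ∘L φ = ContinuousLinearMap.id ℝ (TangentSpace 𝓘(ℝ, EM) x)})
    (fun x φ hφ ψ hψ a b _ _ hab => by
      have h : E.anchor x ∘L (a • φ + b • ψ) = (a + b) • ContinuousLinearMap.id ℝ _ := by
        rw [ContinuousLinearMap.comp_add, ContinuousLinearMap.comp_smul,
          ContinuousLinearMap.comp_smul, hφ, hψ, add_smul]
      rw [hab, one_smul] at h
      exact h)
    (fun x₀ => by
      set e := trivializationAt (EM →L[ℝ] EM × EG) E.HomAt x₀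
      have hcoord : ∀ y ∈ e.baseSet, (e ⟨y, e.symm y (ContinuousLinearMap.inl ℝ EM EG)⟩).2 =
          ContinuousLinearMap.inl ℝ EM EG := fun y hy =>
        congrArg Prod.snd (e.apply_mk_symm hy (ContinuousLinearMap.inl ℝ EM EG))
      refine ⟨e.baseSet, e.open_baseSet.mem_nhds (mem_baseSet_trivializationAt _ _ x₀),
        fun y => e.symm y (ContinuousLinearMap.inl ℝ EM EG), ?_, fun y hy => ?_⟩
      · refine (Bundle.Trivialization.contMDiffOn_section_baseSet_iff e).2 ?_
        exact contMDiffOn_const.congr hcoord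
      · exact E.anchor_comp_eq_id hy.2 (hcoord y hy))
  exact ⟨D, D.contMDiff, hD⟩

lemma nonempty_connection [FiniteDimensional ℝ EM] [T2Space M] [SecondCountableTopology M] :
    Nonempty E.Connection := by
  obtain ⟨D, hD, hη⟩ := E.exists_section_anchor_comp
  exact ⟨⟨D, ContMDiff.clm_bundle_apply (b := fun v : TangentBundle 𝓘(ℝ, EM) M => v.proj)
    (ϕ := fun v => D v.proj) (v := fun v => v.snd)
    (hD.comp (Bundle.contMDiff_proj _)) contMDiff_id, hη⟩⟩

/-! ### The bijection between `Hom(TM, ad(E))` and `𝒞(E)` defined by a connection -/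

variable {E}

/-- Seen as a section of `Hom(TM, At(E))`, a connection is smooth. -/
lemma Connection.contMDiff_section [FiniteDimensional ℝ EM] (D : E.Connection) :
    ContMDiff 𝓘(ℝ, EM) (𝓘(ℝ, EM).prod 𝓘(ℝ, EM →L[ℝ] EM × EG)) ∞
      (fun x => TotalSpace.mk' (EM →L[ℝ] EM × EG) (E := E.HomAt) x (D.hom x)) := by
  intro x₀
  rw [contMDiffAt_hom_bundle]
  refine ⟨contMDiffAt_id, contMDiffAt_clm_of_forall_apply fun v => ?_⟩
  set e := trivializationAt EM (TangentSpace 𝓘(ℝ, EM) : M → Type _) x₀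
  have hx₀ : x₀ ∈ e.baseSet := mem_baseSet_trivializationAt EM _ x₀
  -- the coordinates of `D`, evaluated at `v`, are those of the image under `D` of the local vector
  -- field with constant coordinates `v`
  have h1 : ContMDiffAt 𝓘(ℝ, EM) 𝓘(ℝ, EM).tangent ∞
      (fun y => (⟨y, e.symmL ℝ y v⟩ : TangentBundle 𝓘(ℝ, EM) M)) x₀ := by
    refine (Bundle.contMDiffAt_section x₀).2 ?_
    refine (contMDiffAt_const (c := v)).congr_of_eventuallyEq ?_
    filter_upwards [e.open_baseSet.mem_nhds hx₀] with y hy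
    rw [e.symmL_apply hy]
    exact congrArg Prod.snd (e.apply_mk_symm hy v)
  have h2 := (D.contMDiff_hom _).comp x₀ h1
  refine ((Bundle.contMDiffAt_section x₀).1 h2).congr_of_eventuallyEq ?_
  filter_upwards [(trivializationAt (EM × EG) E.At x₀).open_baseSet.mem_nhds
    (mem_baseSet_trivializationAt (EM × EG) E.At x₀)] with y hy
  exact (trivializationAt (EM × EG) E.At x₀).continuousLinearMapAt_apply_of_mem ℝ hy _

variable (D : E.Connection)

/-- The bijection `(x, A) ↦ ι₀ ∘ A + D(x)` from `Hom(TM, ad(E))` to `𝒞(E)`. -/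
noncomputable def Connection.equiv : TotalSpace (EM →L[ℝ] EG) E.HomAd ≃ E.ConnBundle where
  toFun p := ⟨p.proj, p.snd +ᵥ D.toFiber p.proj⟩
  invFun c := ⟨c.proj, (c.snd -ᵥ D.toFiber c.proj : E.HomAd c.proj)⟩
  left_inv p := by simp
  right_inv c := by simp

variable [FiniteDimensional ℝ EM]

/-- Translation by the connection `D` on `Hom(TM, At(E))`. -/
noncomputable def Connection.translation :
    Diffeomorph (𝓘(ℝ, EM).prod 𝓘(ℝ, EM →L[ℝ] EM × EG)) (𝓘(ℝ, EM).prod 𝓘(ℝ, EM →L[ℝ] EM × EG))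
      (TotalSpace (EM →L[ℝ] EM × EG) E.HomAt) (TotalSpace (EM →L[ℝ] EM × EG) E.HomAt) ∞ :=
  translationDiffeomorph D.hom D.contMDiff_section

lemma connIncl_equiv (p : TotalSpace (EM →L[ℝ] EG) E.HomAd) :
    E.connIncl (D.equiv p) = D.translation (E.homIncl p) := rfl

lemma homIncl_equiv_symm (c : E.ConnBundle) :
    E.homIncl (D.equiv.symm c) = D.translation.symm (E.connIncl c) := by
  obtain ⟨p, rfl⟩ := D.equiv.surjective c
  rw [connIncl_equiv, Equiv.symm_apply_apply, Diffeomorph.symm_apply_apply]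

/-- The homeomorphism `(x, A) ↦ ι₀ ∘ A + D(x)` from `Hom(TM, ad(E))` onto `𝒞(E)`. -/
noncomputable def Connection.homeomorph : TotalSpace (EM →L[ℝ] EG) E.HomAd ≃ₜ E.ConnBundle where
  toEquiv := D.equiv
  continuous_toFun := continuous_induced_rng.2
    (D.translation.continuous.comp E.contMDiff_homIncl.continuous)
  continuous_invFun := continuous_iff_continuousAt.2 fun c => by
    refine E.continuousAt_homIncl_comp_iff.1 ?_
    have h : Continuous fun c => D.translation.symm (E.connIncl c) :=
      D.translation.symm.continuous.comp continuous_induced_dom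
    exact (h.congr fun c => (homIncl_equiv_symm D c).symm).continuousAt

/-- The smooth structure of `𝒞(E)`: that of `Hom(TM, ad(E))`, transported along
`(x, A) ↦ ι₀ ∘ A + D(x)`. -/
@[reducible]
noncomputable def Connection.chartedSpace :
    ChartedSpace (ModelProd EM (EM →L[ℝ] EG)) E.ConnBundle :=
  D.homeomorph.symm.pullbackChartedSpace (ModelProd EM (EM →L[ℝ] EG))

lemma connIncl_injective : Function.Injective E.connIncl := by
  rintro ⟨x, φ⟩ ⟨y, ψ⟩ h
  obtain rfl : x = y := congrArg TotalSpace.proj h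
  have h2 : φ.1 = ψ.1 := TotalSpace.mk_injective x h
  rw [Subtype.ext h2]

/-! ### The smooth structure of `𝒞(E)` -/

/-- The diffeomorphism `(x, A) ↦ ι₀ ∘ A + D(x)` from `Hom(TM, ad(E))` onto `𝒞(E)`. -/
noncomputable def Connection.diffeomorph :
    letI := D.chartedSpace
    Diffeomorph (𝓘(ℝ, EM).prod 𝓘(ℝ, EM →L[ℝ] EG)) (𝓘(ℝ, EM).prod 𝓘(ℝ, EM →L[ℝ] EG))
      (TotalSpace (EM →L[ℝ] EG) E.HomAd) E.ConnBundle ∞ :=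
  letI := D.chartedSpace
  { toEquiv := D.equiv
    contMDiff_toFun := D.homeomorph.symm.contMDiff_pullback_symm
    contMDiff_invFun := D.homeomorph.symm.contMDiff_pullback }

/-- The splitting `((x, B), C) ↦ (x, (C, B))` of `EM × Hom(EM, EM × EG)` by which the inclusion of
`𝒞(E)` in suitable charts becomes the inclusion of the first factor. -/
noncomputable def modelSplitting (EM EG : Type*) [NormedAddCommGroup EM] [NormedSpace ℝ EM]
    [NormedAddCommGroup EG] [NormedSpace ℝ EG] :
    ((EM × (EM →L[ℝ] EG)) × (EM →L[ℝ] EM)) ≃L[ℝ] EM × (EM →L[ℝ] EM × EG) where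
  toFun q := (q.1.1, q.2.prod q.1.2)
  invFun q := ((q.1, ContinuousLinearMap.snd ℝ EM EG ∘L q.2),
    ContinuousLinearMap.fst ℝ EM EG ∘L q.2)
  map_add' _ _ := rfl
  map_smul' _ _ := rfl
  left_inv _ := rfl
  right_inv _ := rfl
  continuous_toFun := continuous_fst.fst.prodMk
    ((ContinuousLinearMap.prodₗᵢ (𝕜 := ℝ) (E := EM) (F := EM) (G := EG) ℝ).continuous.comp
      (continuous_snd.prodMk continuous_fst.snd))
  continuous_invFun := (continuous_fst.prodMk (continuous_const.clm_comp continuous_snd)).prodMk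
    (continuous_const.clm_comp continuous_snd)

/-- In bundle charts, `A ↦ ι₀ ∘ A` is the inclusion of the first factor of `modelSplitting`. -/
lemma chartAt_homIncl (p q : TotalSpace (EM →L[ℝ] EG) E.HomAd)
    (hq : q.proj ∈ (trivializationAt (EM × EG) E.At p.proj).baseSet) :
    chartAt (ModelProd EM (EM →L[ℝ] EM × EG)) (E.homIncl p) (E.homIncl q) =
      modelSplitting EM EG (chartAt (ModelProd EM (EM →L[ℝ] EG)) p q, 0) := by
  rw [hom_chart, hom_chart]
  refine Prod.ext rfl ?_
  refine (E.inCoordinates_adIncl_comp hq q.2).trans ?_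
  rfl

/-- The inclusion of `𝒞(E)` is an immersion: the translation by `-D` turns it into the map
`A ↦ ι₀ ∘ A`, which is linear in bundle charts. -/
lemma Connection.isImmersion_connIncl :
    letI := D.chartedSpace
    Manifold.IsImmersion (𝓘(ℝ, EM).prod 𝓘(ℝ, EM →L[ℝ] EG))
      (𝓘(ℝ, EM).prod 𝓘(ℝ, EM →L[ℝ] EM × EG)) ∞ E.connIncl := by
  let := D.chartedSpace
  have : IsManifold (𝓘(ℝ, EM).prod 𝓘(ℝ, EM →L[ℝ] EG)) ∞ E.ConnBundle :=
    D.homeomorph.symm.isManifold_pullback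
  refine Manifold.IsImmersionOfComplement.isImmersion (F := EM →L[ℝ] EM) fun c => ?_
  obtain ⟨p, rfl⟩ := D.equiv.surjective c
  -- the chart `φ ∘ (Ψ_D)⁻¹` of `𝒞(E)`, and the chart `ψ` translated by `-D`
  let ψ := chartAt (ModelProd EM (EM →L[ℝ] EM × EG)) (E.homIncl p)
  let φ := chartAt (ModelProd EM (EM →L[ℝ] EG)) p
  let T := D.translation.symm
  have hψ := IsManifold.chart_mem_maximalAtlas (I := 𝓘(ℝ, EM).prod 𝓘(ℝ, EM →L[ℝ] EM × EG))
    (n := ∞) (E.homIncl p)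
  have hp : D.homeomorph.symm (D.equiv p) = p := D.equiv.symm_apply_apply p
  refine Manifold.IsImmersionAtOfComplement.mk_of_continuousAt
    continuous_induced_dom.continuousAt (modelSplitting EM EG)
    (D.homeomorph.symm.transOpenPartialHomeomorph φ)
    (T.toHomeomorph.transOpenPartialHomeomorph ψ) ?_ ?_ ?_ ?_ ?_
  · simp [hp, φ]
  · simp [connIncl_equiv, T, ψ]
  · exact IsManifold.subset_maximalAtlas (mem_image_of_mem _ (chart_mem_atlas _ p))
  · refine OpenPartialHomeomorph.mem_maximalAtlas_of_contMDiffOn _ ?_ ?_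
    · exact (contMDiffOn_of_mem_maximalAtlas hψ).comp T.contMDiff.contMDiffOn fun _ h => h
    · exact T.symm.contMDiff.comp_contMDiffOn (contMDiffOn_symm_of_mem_maximalAtlas hψ)
  · intro u hu
    have hu' : u ∈ φ.target := by
      simpa [φ] using! hu
    have hq := φ.map_target hu'
    have h1 : T (E.connIncl (D.equiv (φ.symm u))) = E.homIncl (φ.symm u) :=
      D.translation.symm_apply_apply (E.homIncl (φ.symm u))
    have h2 := chartAt_homIncl p (φ.symm u) (by
      have := hq
      simp only [φ, FiberBundle.chartedSpace_chartAt] at this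
      exact this.1.2)
    have h3 : φ (φ.symm u) = u := φ.right_inv hu'
    change ψ (T (E.connIncl (D.equiv (φ.symm u)))) = modelSplitting EM EG (u, 0)
    rw [h1]
    refine h2.trans ?_
    exact congrArg (fun w => modelSplitting EM EG (w, 0)) h3

lemma Connection.isSmoothEmbedding_connIncl :
    letI := D.chartedSpace
    Manifold.IsSmoothEmbedding (𝓘(ℝ, EM).prod 𝓘(ℝ, EM →L[ℝ] EG))
      (𝓘(ℝ, EM).prod 𝓘(ℝ, EM →L[ℝ] EM × EG)) ∞ E.connIncl :=
  letI := D.chartedSpace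
  ⟨D.isImmersion_connIncl, ⟨⟨rfl⟩, connIncl_injective⟩⟩

lemma Connection.isSmoothAffineBundle :
    letI := D.chartedSpace
    IsSmoothAffineBundle EM (EM →L[ℝ] EG) E.HomAd E.ConnFiber := by
  let := D.chartedSpace
  refine ⟨inferInstance, D.homeomorph.symm.isManifold_pullback, fun x => ?_⟩
  let e := trivializationAt (EM →L[ℝ] EG) E.HomAd x
  let Φ : Trivialization (EM →L[ℝ] EG) (π (EM →L[ℝ] EG) E.ConnFiber) :=
    e.compHomeomorph D.homeomorph.symm
  refine ⟨e, Φ, inferInstance, mem_baseSet_trivializationAt _ _ x, Subset.rfl, ?_, ?_, ?_⟩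
  · exact e.contMDiffOn.comp D.diffeomorph.symm.contMDiff.contMDiffOn fun _ h => h
  · exact D.diffeomorph.contMDiff.comp_contMDiffOn e.contMDiffOn_symm
  · intro y hy v a
    have h : (D.homeomorph.symm ⟨y, v +ᵥ a⟩ : TotalSpace (EM →L[ℝ] EG) E.HomAd) =
        ⟨y, v + (a -ᵥ D.toFiber y : E.HomAd y)⟩ :=
      congrArg (TotalSpace.mk y) (vadd_vsub_assoc v a (D.toFiber y))
    change (e (D.homeomorph.symm ⟨y, v +ᵥ a⟩)).2 = _
    rw [h]
    exact (e.linear ℝ hy).map_add v (a -ᵥ D.toFiber y : E.HomAd y)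

/-- The difference of two connections is a smooth section of `Hom(TM, ad(E))`. -/
lemma Connection.contMDiff_vsub (D' : E.Connection) :
    ContMDiff 𝓘(ℝ, EM) (𝓘(ℝ, EM).prod 𝓘(ℝ, EM →L[ℝ] EG)) ∞ (fun x =>
      TotalSpace.mk' (EM →L[ℝ] EG) (E := E.HomAd) x (D'.toFiber x -ᵥ D.toFiber x)) := by
  intro x
  refine E.contMDiffAt_homIncl_comp_iff.1 ?_
  have h : ContMDiff 𝓘(ℝ, EM) (𝓘(ℝ, EM).prod 𝓘(ℝ, EM →L[ℝ] EM × EG)) ∞ (fun y =>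
      D.translation.symm (TotalSpace.mk' (EM →L[ℝ] EM × EG) (E := E.HomAt) y (D'.hom y))) :=
    D.translation.symm.contMDiff.comp D'.contMDiff_section
  refine (h x).congr_of_eventuallyEq (Filter.Eventually.of_forall fun y => ?_)
  exact homIncl_equiv_symm D ⟨y, D'.toFiber y⟩

/-- With the smooth structure that `D` defines on `𝒞(E)`, every connection `D'` gives a
diffeomorphism, namely that of `D` after the translation by `D' - D`. -/
lemma Connection.exists_diffeomorph (D' : E.Connection) :
    letI := D.chartedSpace
    ∃ Ψ : Diffeomorph (𝓘(ℝ, EM).prod 𝓘(ℝ, EM →L[ℝ] EG)) (𝓘(ℝ, EM).prod 𝓘(ℝ, EM →L[ℝ] EG))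
        (TotalSpace (EM →L[ℝ] EG) E.HomAd) E.ConnBundle ∞,
      ∀ (x : M) (A : E.HomAd x), Ψ ⟨x, A⟩ = ⟨x, A +ᵥ D'.toFiber x⟩ := by
  let := D.chartedSpace
  refine ⟨(translationDiffeomorph _ (D.contMDiff_vsub D')).trans D.diffeomorph, fun x A => ?_⟩
  refine congrArg (TotalSpace.mk x) ?_
  change (A + (D'.toFiber x -ᵥ D.toFiber x : E.HomAd x)) +ᵥ D.toFiber x = A +ᵥ D'.toFiber x
  rw [add_vadd, vsub_vadd]

end SmoothPrincipalBundle

theorem corollary3p2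
    {EM : Type*} [NormedAddCommGroup EM] [NormedSpace ℝ EM] [FiniteDimensional ℝ EM]
    {EG : Type*} [NormedAddCommGroup EG] [NormedSpace ℝ EG] [FiniteDimensional ℝ EG]
    {EP : Type*} [NormedAddCommGroup EP] [NormedSpace ℝ EP] [FiniteDimensional ℝ EP]
    {M : Type*} [TopologicalSpace M] [ChartedSpace EM M] [IsManifold 𝓘(ℝ, EM) ∞ M]
    [T2Space M] [SecondCountableTopology M] [ConnectedSpace M]
    {G : Type*} [TopologicalSpace G] [ChartedSpace EG G] [Group G] [LieGroup 𝓘(ℝ, EG) ∞ G]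
    [T2Space G] [SecondCountableTopology G]
    {P : Type*} [TopologicalSpace P] [ChartedSpace EP P] [IsManifold 𝓘(ℝ, EP) ∞ P]
    [T2Space P] [SecondCountableTopology P]
    (E : SmoothPrincipalBundle EM EG EP M G P) :
    (∃ _ : ChartedSpace (ModelProd EM (EM →L[ℝ] EG)) E.ConnBundle,
      Manifold.IsSmoothEmbedding (𝓘(ℝ, EM).prod 𝓘(ℝ, EM →L[ℝ] EG))
        (𝓘(ℝ, EM).prod 𝓘(ℝ, EM →L[ℝ] EM × EG)) ∞ E.connIncl ∧
      IsSmoothAffineBundle EM (EM →L[ℝ] EG) E.HomAd E.ConnFiber ∧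
      ∀ D : E.Connection,
        ∃ Ψ : Diffeomorph (𝓘(ℝ, EM).prod 𝓘(ℝ, EM →L[ℝ] EG))
            (𝓘(ℝ, EM).prod 𝓘(ℝ, EM →L[ℝ] EG))
            (TotalSpace (EM →L[ℝ] EG) E.HomAd) E.ConnBundle ∞,
          ∀ (x : M) (A : E.HomAd x), Ψ ⟨x, A⟩ = ⟨x, A +ᵥ D.toFiber x⟩) ∧
    Nonempty E.Connection := by
  obtain ⟨D⟩ := E.nonempty_connection
  exact ⟨⟨D.chartedSpace, D.isSmoothEmbedding_connIncl, D.isSmoothAffineBundle,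
    fun D' => D.exists_diffeomorph D'⟩, ⟨D⟩⟩
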